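/- **Theorem.** Let $d\in\{1,2,3\}$, let $\Omega=\mathbb R^d/\mathbb Z^d$ be the torus with unit cell $(0,1)^d$, and let $X=H^1(\Omega)$ (real-valued functions) be equipped with the inner product $(u,v)_X=\int_\Omega uv+\int_\Omega\nabla u\cdot\nabla v$ and the norm $\|\cdot\|_{H^1(\Omega)}$ it induces. Let $V\in H^{r_v}(\Omega)$ for some real $r_v\ge 2$, with $V\ge V_{\min}$ almost everywhere for some constant $V_{\min}>0$, and let $f\in H^s(\Omega)$ for some real $s\ge 1$. Here, for real $t\ge 0$, $H^t(\Omega)$ is the space of $u\in L^2(\Omega)$ with $\sum_{G\in 2\pi\mathbb Z^d}(1+|G|^2)^t|\widehat u(G)|^2<\infty$, where $\widehat u(G)=\int_\Omega u(x)e^{-iG\cdot x}\,dx$. Consider the energy $$\mathcal E(u)=\frac12\int_\Omega|\nabla u|^2+\frac12\int_\Omega V|u|^2+\frac14\int_\Omega|u|^4-\int_\Omega fu,\qquad u\in X,$$ and let $u^*$ be its (unique) minimiser over $X$. For $N\in\mathbb N$, $N\ge1$, let $X_N\subset X$ be the space of real-valued functions in $\mathrm{span}\{e^{iG\cdot x}: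 G\in2\pi\mathbb Z^d,\ |G|\le2\pi N\}$, where $|\cdot|$ is the Euclidean norm, let $u_N\in X_N$ be the (unique) minimiser of $\mathcal E$ over $X_N$, and let $\Pi_N\colon X\to X_N$ be the $(\cdot,\cdot)_X$-orthogonal projection onto $X_N$. Then there is a constant $C>0$, independent of $N$, such that for all $N\ge1$ $$\|\Pi_Nu^*-u_N\|_{L^2(\Omega)}+N^{-1}\|\Pi_Nu^*-u_N\|_{H^1(\Omega)}\le C\,N^{-3}\,\|\Pi_Nu^*-u^*\|_{H^1(\Omega)}.$$ -/

import Mathlib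

open MeasureTheory
open scoped ContDiff ENNReal

noncomputable section

namespace FourierGP

/-- The `d`-dimensional torus `ℝᵈ / ℤᵈ`, with unit cell `(0, 1)ᵈ`. -/
abbrev Torus (d : ℕ) : Type := UnitAddTorus (Fin d)

/-- Lebesgue measure on the torus, of total mass one. -/
abbrev torusMeasure (d : ℕ) : Measure (Torus d) :=
  Measure.pi fun _ : Fin d => (AddCircle.haarAddCircle : Measure (AddCircle (1 : ℝ)))

/-- The real Hilbert space `L²(Ω)` of real-valued functions on the torus. -/
abbrev L2 (d : ℕ) : Type := Lp ℝ 2 (torusMeasure d)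

/-- The quotient map from `ℝᵈ` onto the torus. -/
def proj (d : ℕ) (x : Fin d → ℝ) : Torus d := fun i => (x i : AddCircle (1 : ℝ))

/-- Smooth real-valued functions on the torus, i.e. those whose (periodic) lift to `ℝᵈ` is
infinitely differentiable. -/
def IsSmooth {d : ℕ} (φ : Torus d → ℝ) : Prop :=
  ContDiff ℝ ∞ fun x : Fin d → ℝ => φ (proj d x)

/-- The classical partial derivative of a function on the torus in direction `j`. -/
def partialDeriv {d : ℕ} (j : Fin d) (φ : Torus d → ℝ) (t : Torus d) : ℝ :=
  deriv (fun h : ℝ => φ (t + Pi.single j (h : AddCircle (1 : ℝ)))) 0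

/-- `g` is the weak partial derivative of `u` in direction `j`. -/
def IsWeakPartial {d : ℕ} (j : Fin d) (u g : L2 d) : Prop :=
  ∀ φ : Torus d → ℝ, IsSmooth φ →
    ∫ x, u x * partialDeriv j φ x ∂(torusMeasure d) = -∫ x, g x * φ x ∂(torusMeasure d)

/-! ### Elementary facts on smooth functions and weak derivatives -/

lemma proj_isOpenQuotientMap (d : ℕ) : IsOpenQuotientMap (proj d) :=
  IsOpenQuotientMap.piMap (f := fun (_ : Fin d) (x : ℝ) => (x : AddCircle (1 : ℝ)))
    fun _ => QuotientAddGroup.isOpenQuotientMap_mk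

lemma IsSmooth.continuous {d : ℕ} {φ : Torus d → ℝ} (h : IsSmooth φ) : Continuous φ :=
  (proj_isOpenQuotientMap d).isQuotientMap.continuous_iff.2 (ContDiff.continuous h)

lemma partialDeriv_proj {d : ℕ} {φ : Torus d → ℝ} (h : IsSmooth φ) (j : Fin d)
    (x : Fin d → ℝ) :
    partialDeriv j φ (proj d x) =
      fderiv ℝ (fun y : Fin d → ℝ => φ (proj d y)) x (Pi.single j 1) := by
  have hd : DifferentiableAt ℝ (fun y : Fin d → ℝ => φ (proj d y)) x :=
    (ContDiff.differentiable h (by simp)) x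
  have e : (fun t : ℝ => φ (proj d x + Pi.single j (t : AddCircle (1 : ℝ)))) =
      fun t : ℝ => φ (proj d (x + t • Pi.single j (1 : ℝ))) := by
    funext t
    congr 1
    funext i
    rcases eq_or_ne i j with rfl | hij
    · simp [proj]
    · simp [proj, Pi.single_eq_of_ne hij]
  unfold partialDeriv
  rw [e]
  exact hd.lineDeriv_eq_fderiv

lemma IsSmooth.continuous_partialDeriv {d : ℕ} {φ : Torus d → ℝ} (h : IsSmooth φ)
    (j : Fin d) : Continuous (partialDeriv j φ) := by
  refine (proj_isOpenQuotientMap d).isQuotientMap.continuous_iff.2 ?_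
  have e : partialDeriv j φ ∘ proj d = fun x =>
      fderiv ℝ (fun y : Fin d → ℝ => φ (proj d y)) x (Pi.single j 1) :=
    funext fun x => partialDeriv_proj h j x
  rw [e]
  exact (ContDiff.continuous_fderiv h (by simp)).clm_apply continuous_const

lemma integrable_mul {d : ℕ} (u : L2 d) {φ : Torus d → ℝ} (h : Continuous φ) :
    Integrable (fun x => u x * φ x) (torusMeasure d) := by
  obtain ⟨C, hC⟩ := isCompact_univ.exists_bound_of_continuousOn h.continuousOn
  refine Integrable.mul_bdd (c := C) ((Lp.memLp u).integrable (by norm_num))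
    h.aestronglyMeasurable (Filter.Eventually.of_forall fun x => hC x (Set.mem_univ x))

lemma IsWeakPartial.zero {d : ℕ} (j : Fin d) : IsWeakPartial j (0 : L2 d) 0 := by
  intro φ _
  have h0 : ∀ ψ : Torus d → ℝ, ∫ x, (0 : L2 d) x * ψ x ∂(torusMeasure d) = 0 := fun ψ => by
    refine integral_eq_zero_of_ae ?_
    filter_upwards [Lp.coeFn_zero ℝ 2 (torusMeasure d)] with x hx
    rw [hx]
    simp
  rw [h0, h0, neg_zero]

lemma integral_add_mul {d : ℕ} (u v : L2 d) {φ : Torus d → ℝ} (h : Continuous φ) :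
    ∫ x, (u + v) x * φ x ∂(torusMeasure d) =
      ∫ x, u x * φ x ∂(torusMeasure d) + ∫ x, v x * φ x ∂(torusMeasure d) := by
  rw [← integral_add (integrable_mul u h) (integrable_mul v h)]
  refine integral_congr_ae ?_
  filter_upwards [Lp.coeFn_add u v] with x hx
  rw [hx, Pi.add_apply, add_mul]

lemma integral_smul_mul {d : ℕ} (c : ℝ) (u : L2 d) (φ : Torus d → ℝ) :
    ∫ x, (c • u) x * φ x ∂(torusMeasure d) = c * ∫ x, u x * φ x ∂(torusMeasure d) := by
  rw [← integral_const_mul]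
  refine integral_congr_ae ?_
  filter_upwards [Lp.coeFn_smul c u] with x hx
  rw [hx, Pi.smul_apply, smul_eq_mul, mul_assoc]

lemma IsWeakPartial.add {d : ℕ} {j : Fin d} {u v g k : L2 d} (hu : IsWeakPartial j u g)
    (hv : IsWeakPartial j v k) : IsWeakPartial j (u + v) (g + k) := by
  intro φ hφ
  rw [integral_add_mul u v (hφ.continuous_partialDeriv j), integral_add_mul g k hφ.continuous,
    hu φ hφ, hv φ hφ, neg_add]

lemma IsWeakPartial.smul {d : ℕ} {j : Fin d} {u g : L2 d} (c : ℝ)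
    (hu : IsWeakPartial j u g) : IsWeakPartial j (c • u) (c • g) := by
  intro φ hφ
  rw [integral_smul_mul, integral_smul_mul, hu φ hφ, mul_neg]

/-! ### The space `X = H¹(Ω)` -/

/-- The space `X = H¹(Ω)` as a set of pairs of a function `u ∈ L²(Ω)` and its weak gradient
`∇u ∈ L²(Ω)ᵈ`, inside the Hilbert sum `L²(Ω) ⊕ L²(Ω)ᵈ`. -/
def h1Submodule (d : ℕ) : Submodule ℝ (WithLp 2 (L2 d × PiLp 2 fun _ : Fin d => L2 d)) where
  carrier := {w | ∀ j, IsWeakPartial j w.fst (w.snd j)}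
  zero_mem' := fun j => IsWeakPartial.zero j
  add_mem' := fun ha hb j => (ha j).add (hb j)
  smul_mem' := fun c _ ha j => (ha j).smul c

/-- The inner product space `X = H¹(Ω)`. Its inner product is
`(u, v)_X = ∫ u v + ∫ ∇u · ∇v` (see `H1.inner_eq`), with the corresponding norm, and an element
is determined by its function (see `H1.fn_injective`). -/
def H1 (d : ℕ) : Type := h1Submodule d

instance instNormedAddCommGroupH1 (d : ℕ) : NormedAddCommGroup (H1 d) :=
  inferInstanceAs (NormedAddCommGroup (h1Submodule d))

instance instInnerProductSpaceH1 (d : ℕ) : InnerProductSpace ℝ (H1 d) :=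
  inferInstanceAs (InnerProductSpace ℝ (h1Submodule d))

/-- The function in `L²(Ω)` underlying an element of `H¹(Ω)`. -/
def H1.fn {d : ℕ} (u : H1 d) : L2 d := u.1.fst

/-- The weak partial derivatives of an element of `H¹(Ω)`. -/
def H1.grad {d : ℕ} (u : H1 d) (j : Fin d) : L2 d := u.1.snd j

lemma H1.inner_eq {d : ℕ} (u v : H1 d) :
    inner ℝ u v = ∫ x, u.fn x * v.fn x ∂(torusMeasure d) +
      ∑ j, ∫ x, u.grad j x * v.grad j x ∂(torusMeasure d) := by
  have h : inner ℝ u v = inner ℝ u.fn v.fn + ∑ j, inner ℝ (u.grad j) (v.grad j) := by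
    change inner ℝ u.1 v.1 = _
    rw [WithLp.prod_inner_apply, PiLp.inner_apply]; rfl
  rw [h]
  simp [L2.inner_def, mul_comm]

/-! ### Fourier coefficients and Sobolev regularity -/

/-- The `k`-th Fourier coefficient `∫ u(x) e^{-2πi k·x} dx` of a real-valued function. -/
def coeff {d : ℕ} (u : L2 d) (k : Fin d → ℤ) : ℂ :=
  UnitAddTorus.mFourierCoeff (fun x => (u x : ℂ)) k

/-- The Euclidean length `|G|` of the wave vector `G = 2πk`, for `k ∈ ℤᵈ`. -/
def waveNumber {d : ℕ} (k : Fin d → ℤ) : ℝ :=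
  √(∑ i, (2 * Real.pi * (k i : ℝ)) ^ 2)

/-- `u` belongs to the Sobolev space `Hˢ(Ω)` of the torus, `s ≥ 0`: the sum over `G = 2πk` of
`(1 + |G|²)ˢ |û(G)|²` is finite. -/
def MemSobolev {d : ℕ} (s : ℝ) (u : L2 d) : Prop :=
  Summable fun k : Fin d → ℤ => (1 + waveNumber k ^ 2) ^ s * ‖coeff u k‖ ^ 2

lemma isSmooth_mFourier {d : ℕ} (k : Fin d → ℤ) :
    ContDiff ℝ ∞ fun x : Fin d → ℝ => UnitAddTorus.mFourier k (proj d x) := by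
  have e : (fun x : Fin d → ℝ => UnitAddTorus.mFourier k (proj d x)) =
      fun x => ∏ i, Complex.exp (2 * Real.pi * Complex.I * k i * (x i : ℂ) / (1 : ℝ)) := by
    funext x
    simp only [UnitAddTorus.mFourier, ContinuousMap.coe_mk, proj]
    exact Finset.prod_congr rfl fun i _ => fourier_coe_apply
  rw [e]
  refine contDiff_prod fun i _ => ContDiff.cexp ?_
  refine ContDiff.div_const (contDiff_const.mul ?_) _
  exact Complex.ofRealCLM.contDiff.comp (contDiff_apply ℝ ℝ i)

lemma integrable_coeff {d : ℕ} (u : L2 d) (k : Fin d → ℤ) :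
    Integrable (fun x => UnitAddTorus.mFourier (-k) x • (u x : ℂ)) (torusMeasure d) := by
  refine Integrable.bdd_mul (c := ‖UnitAddTorus.mFourier (-k)‖)
    ((Lp.memLp u).integrable (by norm_num)).ofReal
    (UnitAddTorus.mFourier (-k)).continuous.aestronglyMeasurable
    (Filter.Eventually.of_forall fun x => (UnitAddTorus.mFourier (-k)).norm_coe_le_norm x)

lemma coeff_add {d : ℕ} (u v : L2 d) (k : Fin d → ℤ) :
    coeff (u + v) k = coeff u k + coeff v k := by
  refine Eq.trans ?_ (integral_add (integrable_coeff u k) (integrable_coeff v k))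
  refine integral_congr_ae ?_
  filter_upwards [Lp.coeFn_add u v] with x hx
  simp only [hx, Pi.add_apply, Complex.ofReal_add, smul_add]

lemma coeff_smul {d : ℕ} (c : ℝ) (u : L2 d) (k : Fin d → ℤ) :
    coeff (c • u) k = c • coeff u k := by
  refine Eq.trans ?_ (integral_smul c
    fun x => UnitAddTorus.mFourier (-k) x • (u x : ℂ))
  refine integral_congr_ae ?_
  filter_upwards [Lp.coeFn_smul c u] with x hx
  simp only [hx, Pi.smul_apply, smul_eq_mul, Complex.ofReal_mul, Complex.real_smul]
  ring

lemma eq_zero_of_coeff {d : ℕ} (u : L2 d) (h : ∀ k, coeff u k = 0) : u = 0 := by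
  let w : Lp (α := Torus d) ℂ 2 (torusMeasure d) := Complex.ofRealCLM.compLp u
  have hw : ∀ᵐ x ∂(torusMeasure d), w x = (u x : ℂ) := Complex.ofRealCLM.coeFn_compLp u
  have hw0 : w = 0 := by
    refine UnitAddTorus.mFourierBasis.repr.injective (lp.ext (funext fun k => ?_))
    refine (UnitAddTorus.mFourierBasis_repr w k).trans ?_
    rw [map_zero]
    refine Eq.trans ?_ (h k)
    refine integral_congr_ae ?_
    filter_upwards [hw] with x hx
    simp only [hx]
  refine (Lp.eq_zero_iff_ae_eq_zero).2 ?_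
  filter_upwards [hw, (Lp.eq_zero_iff_ae_eq_zero).1 hw0] with x h1 h2
  rw [h1] at h2
  exact Complex.ofReal_eq_zero.1 h2

/-- A function in `H¹(Ω)` has only one weak gradient. -/
lemma H1.fn_injective (d : ℕ) : Function.Injective (H1.fn : H1 d → L2 d) := by
  intro u v huv
  have hfst : (u - v).1.fst = 0 := sub_eq_zero.2 huv
  have hsnd : ∀ j, (u - v).1.snd j = 0 := by
    intro j
    have key : ∀ φ : Torus d → ℝ, IsSmooth φ →
        ∫ x, (u - v).1.snd j x * φ x ∂(torusMeasure d) = 0 := by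
      intro φ hφ
      have h := (u - v).2 j φ hφ
      rw [hfst] at h
      have h0 : ∫ x, (0 : L2 d) x * partialDeriv j φ x ∂(torusMeasure d) = 0 := by
        refine integral_eq_zero_of_ae ?_
        filter_upwards [Lp.coeFn_zero ℝ 2 (torusMeasure d)] with x hx
        rw [hx]
        simp
      rw [h0] at h
      linarith
    generalize (u - v).1.snd j = g at key
    refine eq_zero_of_coeff g fun k => ?_
    have hre := key (fun x => (UnitAddTorus.mFourier (-k) x).re)
      (Complex.reCLM.contDiff.comp (isSmooth_mFourier (-k)))
    have him := key (fun x => (UnitAddTorus.mFourier (-k) x).im)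
      (Complex.imCLM.contDiff.comp (isSmooth_mFourier (-k)))
    have hi := integrable_coeff g k
    have e1 := Complex.reCLM.integral_comp_comm hi
    have e2 := Complex.imCLM.integral_comp_comm hi
    refine Complex.ext (e1.symm.trans ?_) (e2.symm.trans ?_)
    · refine Eq.trans (integral_congr_ae (Filter.Eventually.of_forall fun x => ?_)) hre
      simp [mul_comm]
    · refine Eq.trans (integral_congr_ae (Filter.Eventually.of_forall fun x => ?_)) him
      simp [mul_comm]
  have h0 : u - v = 0 := by
    refine Subtype.ext ((WithLp.equiv 2 _).injective (Prod.ext hfst ?_))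
    refine (WithLp.equiv 2 _).injective (funext hsnd)
  exact sub_eq_zero.1 h0

/-! ### The source problem and its Fourier discretisation -/

/-- The energy `½ ∫ |∇u|² + ½ ∫ V |u|² + ¼ ∫ |u|⁴ - ∫ f u`. -/
def energy {d : ℕ} (V f : L2 d) (u : H1 d) : ℝ :=
  1 / 2 * ∫ x, ∑ j, (u.grad j x) ^ 2 ∂(torusMeasure d)
    + 1 / 2 * ∫ x, V x * (u.fn x) ^ 2 ∂(torusMeasure d)
    + 1 / 4 * ∫ x, (u.fn x) ^ 4 ∂(torusMeasure d)
    - ∫ x, f x * u.fn x ∂(torusMeasure d)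

/-- The complex span of the Fourier modes `e_G`, `G ∈ 2πℤᵈ`, with `|G| ≤ 2πN`. -/
def trigPoly (d N : ℕ) : Submodule ℂ C(Torus d, ℂ) :=
  Submodule.span ℂ (UnitAddTorus.mFourier '' {k | waveNumber k ≤ 2 * Real.pi * N})

/-- The Fourier approximation space `X_N ⊆ X`: the real-valued functions in the span of the
Fourier modes `e_G`, `G ∈ 2πℤᵈ`, with `|G| ≤ 2πN`. -/
def fourierSpace (d N : ℕ) : Submodule ℝ (H1 d) where
  carrier := {u | ∃ p ∈ trigPoly d N, ∀ᵐ x ∂(torusMeasure d), (u.fn x : ℂ) = p x}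
  zero_mem' := by
    refine ⟨0, Submodule.zero_mem _, ?_⟩
    filter_upwards [Lp.coeFn_zero ℝ 2 (torusMeasure d)] with x hx
    change (((0 : L2 d) x : ℝ) : ℂ) = 0
    rw [hx]
    simp
  add_mem' := by
    rintro u v ⟨p, hp, hup⟩ ⟨q, hq, hvq⟩
    refine ⟨p + q, Submodule.add_mem _ hp hq, ?_⟩
    filter_upwards [hup, hvq, Lp.coeFn_add u.fn v.fn] with x h1 h2 h3
    change (((u.fn + v.fn : L2 d) x : ℝ) : ℂ) = p x + q x
    rw [h3, ← h1, ← h2]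
    simp
  smul_mem' := by
    rintro c u ⟨p, hp, hup⟩
    refine ⟨(c : ℂ) • p, Submodule.smul_mem _ _ hp, ?_⟩
    filter_upwards [hup, Lp.coeFn_smul c u.fn] with x h1 h2
    change (((c • u.fn : L2 d) x : ℝ) : ℂ) = (c : ℂ) * p x
    rw [h2, ← h1]
    simp

lemma finite_waves (d N : ℕ) : {k : Fin d → ℤ | waveNumber k ≤ 2 * Real.pi * N}.Finite := by
  refine (Set.finite_Icc (fun _ : Fin d => -(N : ℤ)) fun _ => (N : ℤ)).subset fun k hk => ?_
  have hpi := Real.pi_pos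
  have h : ∀ i, |k i| ≤ (N : ℤ) := by
    intro i
    have h1 : |2 * Real.pi * (k i : ℝ)| ≤ 2 * Real.pi * N := by
      refine le_trans ?_ (show waveNumber k ≤ 2 * Real.pi * N from hk)
      rw [← Real.sqrt_sq_eq_abs]
      exact Real.sqrt_le_sqrt (Finset.single_le_sum
        (f := fun i => (2 * Real.pi * (k i : ℝ)) ^ 2) (fun _ _ => sq_nonneg _)
        (Finset.mem_univ i))
    rw [abs_mul, abs_of_pos (by positivity)] at h1
    have h2 := le_of_mul_le_mul_left h1 (by positivity)
    exact_mod_cast h2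
  exact ⟨fun i => (abs_le.1 (h i)).1, fun i => (abs_le.1 (h i)).2⟩

lemma coeff_eq_zero {d N : ℕ} {u : H1 d} (hu : u ∈ fourierSpace d N) {k : Fin d → ℤ}
    (hk : ¬ waveNumber k ≤ 2 * Real.pi * N) : coeff u.fn k = 0 := by
  obtain ⟨p, hp, hup⟩ := hu
  have key : ∀ q ∈ trigPoly d N,
      inner ℂ (UnitAddTorus.mFourierLp 2 k : Lp (α := Torus d) ℂ 2 (torusMeasure d))
        (ContinuousMap.toLp 2 (torusMeasure d) ℂ q) = 0 := by
    intro q hq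
    induction hq using Submodule.span_induction with
    | mem q hq =>
      obtain ⟨m, hm, rfl⟩ := hq
      exact UnitAddTorus.orthonormal_mFourier.2 fun h : k = m => hk (h ▸ hm)
    | zero => rw [map_zero, inner_zero_right]
    | add q r _ _ h1 h2 => rw [map_add, inner_add_right, h1, h2, add_zero]
    | smul c q _ h1 => rw [map_smul, inner_smul_right, h1, mul_zero]
  refine Eq.trans ?_ (key p hp)
  rw [← congrFun UnitAddTorus.coe_mFourierBasis k, ← HilbertBasis.repr_apply_apply,
    UnitAddTorus.mFourierBasis_repr]
  refine integral_congr_ae ?_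
  filter_upwards [hup, ContinuousMap.coeFn_toLp (p := 2) (𝕜 := ℂ) (torusMeasure d) p] with x h1 h2
  simp only [h1, h2]

instance finiteDimensional_fourierSpace (d N : ℕ) :
    FiniteDimensional ℝ (fourierSpace d N) := by
  have : Finite {k : Fin d → ℤ | waveNumber k ≤ 2 * Real.pi * N} := finite_waves d N
  let T : fourierSpace d N →ₗ[ℝ] {k : Fin d → ℤ | waveNumber k ≤ 2 * Real.pi * N} → ℂ :=
    { toFun := fun u k => coeff u.1.fn k.1
      map_add' := fun u v => funext fun k => coeff_add u.1.fn v.1.fn k.1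
      map_smul' := fun c u => funext fun k => coeff_smul c u.1.fn k.1 }
  refine FiniteDimensional.of_injective T ((injective_iff_map_eq_zero T).2 fun u hu => ?_)
  have h : u.1.fn = 0 := by
    refine eq_zero_of_coeff _ fun k => ?_
    by_cases hk : waveNumber k ≤ 2 * Real.pi * N
    · exact congrFun hu ⟨k, hk⟩
    · exact coeff_eq_zero u.2 hk
  exact Subtype.ext (H1.fn_injective d h)

/-- The `(·, ·)_X`-orthogonal projection `Π_N` of `X` onto `X_N`. -/
def projN (d N : ℕ) : H1 d →L[ℝ] H1 d :=
  (fourierSpace d N).starProjection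

end FourierGP

end

noncomputable section

namespace FourierGP

/-! ### Weighted convolution inequalities for nonnegative series -/

/-! By Parseval the inner product of `X` is diagonal in Fourier space, so `Π_N` truncates to `|G| ≤
2πN`. Hence `w = u* - Π_N u*` carries only higher frequencies and is orthogonal to `X_N` for the
gradient form too. Put `p = Π_N u*`, `q = u_N`, `e = p - q ∈ X_N`. Subtracting the two
Euler–Lagrange equations tested in `X_N` and factoring differences of cubes gives `∫ ∇e·∇v + ∫ a e v
= -∫ w b v` with `a = V + p² + pq + q² ≥ Vmin` and `b = V + u*² + u* p + p²` (`formB_error_eq`).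

The duality argument takes place inside `X_N`: let `ψ ∈ X_N` solve the problem with the same
symmetric form and right-hand side `e`. Then `‖e‖² = -∫ w (bψ)`. Since `w` has high frequencies
only, `|∫ w z| ≤ N⁻³ ‖w‖_{H¹} ‖z‖_{H²}` (`ofReal_inner_sq_le`), and since `H²` is an algebra for `d
≤ 3` (`sobSq_two_mul_le`), `‖bψ‖_{H²} ≤ C ‖ψ‖_{H²} ≤ C' ‖e‖`. Cancelling `‖e‖` gives the `L²` rate;
the inverse inequality on `X_N` gives the `H¹` rate.

The constants are uniform because `u*`, `u_N` and `ψ` have `H²` bounds independent of `N`. The space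
`X_N` is translation invariant, so an equation on it may be tested with `2u - u(·+s) - u(·-s)`,
whose Fourier multiplier is `|e^{iG·s} - 1|² ≥ 0`. The cubic term then has a favourable sign by
monotonicity, and dividing by `|s|²` and letting `s → 0` controls the second derivatives
(`rsob_two_le`). The embedding `H² ⊂ L^∞` and the algebra property rest on `∑ (1 + |G|²)⁻² < ∞`,
which is where `d ≤ 3` enters. -/

/-- The Cauchy–Schwarz inequality for sums of extended nonnegative reals. -/
lemma ennreal_tsum_mul_sq_le {ι : Type*} (f g : ι → ℝ≥0∞) :
    (∑' i, f i * g i) ^ 2 ≤ (∑' i, f i ^ 2) * ∑' i, g i ^ 2 := by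
  have key : ∑' i, f i * g i ≤
      (∑' i, f i ^ 2) ^ (1 / 2 : ℝ) * (∑' i, g i ^ 2) ^ (1 / 2 : ℝ) := by
    rw [ENNReal.tsum_eq_iSup_sum]
    refine iSup_le fun s => ?_
    refine (ENNReal.inner_le_Lp_mul_Lq s f g Real.HolderConjugate.two_two).trans ?_
    simp only [ENNReal.rpow_two]
    gcongr <;> exact ENNReal.sum_le_tsum s
  refine (pow_le_pow_left' key 2).trans (le_of_eq ?_)
  rw [mul_pow, ← ENNReal.rpow_natCast, ← ENNReal.rpow_natCast, ← ENNReal.rpow_mul,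
    ← ENNReal.rpow_mul]
  norm_num

lemma ennreal_add_sq_le (x y : ℝ≥0∞) : (x + y) ^ 2 ≤ 2 * (x ^ 2 + y ^ 2) := by
  have h := ENNReal.rpow_add_le_mul_rpow_add_rpow x y (p := 2) (by norm_num)
  norm_num at h
  exact h

lemma ennreal_mul_le_add_sq (x y : ℝ≥0∞) : x * y ≤ x ^ 2 + y ^ 2 := by
  rcases le_total x y with h | h
  · exact (mul_le_mul_left h y).trans (by rw [← sq]; exact le_add_self)
  · exact (mul_le_mul_right h x).trans (by rw [← sq]; exact le_self_add)

/-- Weighted `ℓ²` bound for a convolution. -/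
lemma tsum_mul_conv_sq_le {G : Type*} [AddCommGroup G] (ρ τ : G → ℝ≥0∞) (K : ℝ≥0∞)
    (h0 : ∀ k, τ k ≠ 0) (ht : ∀ k, τ k ≠ ⊤)
    (hK : ∀ k, ρ k * ∑' l, (τ l)⁻¹ * (τ (k - l))⁻¹ ≤ K) (a b : G → ℝ≥0∞) :
    ∑' k, ρ k * (∑' l, a l * b (k - l)) ^ 2 ≤
      K * (∑' k, τ k * a k ^ 2) * ∑' k, τ k * b k ^ 2 := by
  have hr : ∀ x : ℝ≥0∞, (x ^ (1 / 2 : ℝ)) ^ 2 = x := fun x => by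
    rw [← ENNReal.rpow_natCast, ← ENNReal.rpow_mul]; norm_num
  have hpt : ∀ k, ρ k * (∑' l, a l * b (k - l)) ^ 2 ≤
      K * ∑' l, (τ l * a l ^ 2) * (τ (k - l) * b (k - l) ^ 2) := by
    intro k
    -- Cauchy–Schwarz is applied after inserting `σ⁻¹ σ` with `σ² = τ(l) τ(k - l)`: the sum of `σ⁻²`
    -- is the kernel controlled by `hK`.
    set σ : G → ℝ≥0∞ := fun l => (τ l * τ (k - l)) ^ (1 / 2 : ℝ)
    have hσ0 : ∀ l, σ l ≠ 0 := fun l => by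
      have := mul_ne_zero (h0 l) (h0 (k - l))
      simp [σ, ENNReal.rpow_eq_zero_iff, h0]
    have hσt : ∀ l, σ l ≠ ⊤ := fun l =>
      ENNReal.rpow_ne_top_of_nonneg (by norm_num) (ENNReal.mul_ne_top (ht l) (ht _))
    have e : ∀ l, a l * b (k - l) = (σ l)⁻¹ * (σ l * (a l * b (k - l))) := fun l => by
      rw [← mul_assoc, ENNReal.inv_mul_cancel (hσ0 l) (hσt l), one_mul]
    have hcs := ennreal_tsum_mul_sq_le (fun l => (σ l)⁻¹) fun l => σ l * (a l * b (k - l))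
    simp only [← e] at hcs
    have e1 : ∀ l, (σ l)⁻¹ ^ 2 = (τ l)⁻¹ * (τ (k - l))⁻¹ := fun l => by
      rw [← ENNReal.inv_pow, hr, ENNReal.mul_inv (Or.inl (h0 l)) (Or.inl (ht l))]
    have e2 : ∀ l, (σ l * (a l * b (k - l))) ^ 2 =
        (τ l * a l ^ 2) * (τ (k - l) * b (k - l) ^ 2) := fun l => by
      rw [mul_pow, hr]; ring
    simp only [e1, e2] at hcs
    calc _ ≤ ρ k * _ := mul_le_mul_right hcs _
      _ ≤ _ := by rw [← mul_assoc]; exact mul_le_mul_left (hK k) _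
  -- Summing over `k` first, Tonelli and translation invariance factor the double sum.
  refine (ENNReal.tsum_le_tsum hpt).trans (le_of_eq ?_)
  rw [ENNReal.tsum_mul_left, ENNReal.tsum_comm, mul_assoc]
  congr 1
  rw [← ENNReal.tsum_mul_right]
  refine tsum_congr fun l => ?_
  rw [ENNReal.tsum_mul_left]
  congr 1
  exact (Equiv.subRight l).tsum_eq fun k => τ k * b k ^ 2

/-! ### The symbol `1 + |G|²` -/

/-- The symbol `1 + |G|²` of `1 - Δ`, as an extended nonnegative real. -/
def symb {d : ℕ} (k : Fin d → ℤ) : ℝ≥0∞ := ENNReal.ofReal (1 + waveNumber k ^ 2)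

lemma waveNumber_sq {d : ℕ} (k : Fin d → ℤ) :
    waveNumber k ^ 2 = ∑ i, (2 * Real.pi * (k i : ℝ)) ^ 2 :=
  Real.sq_sqrt (Finset.sum_nonneg fun _ _ => sq_nonneg _)

lemma waveNumber_nonneg {d : ℕ} (k : Fin d → ℤ) : 0 ≤ waveNumber k := Real.sqrt_nonneg _

lemma one_le_symb {d : ℕ} (k : Fin d → ℤ) : 1 ≤ symb k := by
  rw [symb, ENNReal.one_le_ofReal]
  linarith [sq_nonneg (waveNumber k)]

lemma symb_ne_zero {d : ℕ} (k : Fin d → ℤ) : symb k ≠ 0 :=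
  (zero_lt_one.trans_le (one_le_symb k)).ne'

lemma symb_ne_top {d : ℕ} (k : Fin d → ℤ) : symb k ≠ ⊤ := ENNReal.ofReal_ne_top

/-- From `|x + y|² ≤ 2(|x|² + |y|²)`. This quasi-subadditivity distributes the weight of a product
over its two factors. -/
lemma symb_le {d : ℕ} (k l : Fin d → ℤ) : symb k ≤ 2 * (symb l + symb (k - l)) := by
  have h : waveNumber k ^ 2 ≤ 2 * (waveNumber l ^ 2 + waveNumber (k - l) ^ 2) := by
    simp only [waveNumber_sq, ← Finset.sum_add_distrib, Finset.mul_sum]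
    refine Finset.sum_le_sum fun i _ => ?_
    push_cast [Pi.sub_apply]
    nlinarith [sq_nonneg (2 * Real.pi * (l i : ℝ) - (2 * Real.pi * ((k i : ℝ) - l i)))]
  unfold symb
  rw [← ENNReal.ofReal_add (by positivity) (by positivity),
    show (2 : ℝ≥0∞) = ENNReal.ofReal 2 by simp, ← ENNReal.ofReal_mul (by norm_num)]
  exact ENNReal.ofReal_le_ofReal (by linarith)

lemma symb_sq_le {d : ℕ} (k l : Fin d → ℤ) :
    symb k ^ 2 ≤ 8 * (symb l ^ 2 + symb (k - l) ^ 2) := by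
  refine (pow_le_pow_left' (symb_le k l) 2).trans ?_
  rw [mul_pow]
  refine (mul_le_mul_right (ennreal_add_sq_le _ _) _).trans (le_of_eq ?_)
  rw [← mul_assoc]; norm_num

/-- The lattice sum `∑ (1 + |G|²)⁻²`. -/
def latticeSum (d : ℕ) : ℝ≥0∞ := ∑' k : Fin d → ℤ, (symb k ^ 2)⁻¹

lemma tsum_pi_prod (g : ℤ → ℝ≥0∞) (d : ℕ) :
    ∑' k : Fin d → ℤ, ∏ i, g (k i) = (∑' n, g n) ^ d := by
  induction d with
  | zero => simp [tsum_fintype]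
  | succ n ih =>
    rw [← (Fin.consEquiv fun _ : Fin (n + 1) => ℤ).tsum_eq]
    simp only [Fin.consEquiv_apply, Fin.prod_univ_succ, Fin.cons_zero, Fin.cons_succ]
    rw [ENNReal.tsum_prod (f := fun a (b : Fin n → ℤ) => g a * ∏ i, g (b i))]
    simp only [ENNReal.tsum_mul_left, ih, ENNReal.tsum_mul_right]
    ring

/-- With `A = 1 + |G|² ≥ 1`, `d ≤ 3` gives `A⁻² ≤ (A^(-2/3))^d ≤ ∏ (1 + kᵢ²)^(-2/3)`. The sum over
the lattice thus reduces to a power of a one-dimensional sum with decay `|n|^(-4/3)`. -/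
lemma latticeSum_ne_top {d : ℕ} (hd3 : d ≤ 3) : latticeSum d ≠ ⊤ := by
  set g : ℤ → ℝ := fun n => (1 + (n : ℝ) ^ 2) ^ (-(2 / 3) : ℝ)
  have hg0 : ∀ n, 0 ≤ g n := fun n => by positivity
  have hg : Summable g := by
    refine Summable.of_norm_bounded_eventually
      (Real.summable_abs_int_rpow (b := 4 / 3) (by norm_num)) ?_
    filter_upwards [(Set.finite_singleton (0 : ℤ)).compl_mem_cofinite] with n hn
    have hn' : 0 < |(n : ℝ)| := abs_pos.2 (by exact_mod_cast hn)
    rw [Real.norm_of_nonneg (hg0 n), show (-(4 / 3) : ℝ) = 2 * (-(2 / 3)) by norm_num,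
      Real.rpow_mul hn'.le]
    refine Real.rpow_le_rpow_of_nonpos (by positivity) ?_ (by norm_num)
    rw [Real.rpow_two, sq_abs]
    linarith
  have hle : latticeSum d ≤ ∑' k : Fin d → ℤ, ∏ i, ENNReal.ofReal (g (k i)) := by
    refine ENNReal.tsum_le_tsum fun k => ?_
    rw [← ENNReal.ofReal_prod_of_nonneg fun i _ => hg0 _, symb,
      ← ENNReal.ofReal_pow (by positivity), ← ENNReal.ofReal_inv_of_pos (by positivity)]
    refine ENNReal.ofReal_le_ofReal ?_
    set A : ℝ := 1 + waveNumber k ^ 2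
    have hA : 1 ≤ A := by simp only [A]; linarith [sq_nonneg (waveNumber k)]
    have hi : ∀ i, A ^ (-(2 / 3) : ℝ) ≤ g (k i) := fun i => by
      refine Real.rpow_le_rpow_of_nonpos (by positivity) ?_ (by norm_num)
      have h1 : (2 * Real.pi * (k i : ℝ)) ^ 2 ≤ waveNumber k ^ 2 := by
        rw [waveNumber_sq]
        exact Finset.single_le_sum (f := fun i => (2 * Real.pi * (k i : ℝ)) ^ 2)
          (fun _ _ => sq_nonneg _) (Finset.mem_univ i)
      have h2 : (k i : ℝ) ^ 2 ≤ (2 * Real.pi * (k i : ℝ)) ^ 2 := by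
        rw [mul_pow]
        have : (1 : ℝ) ≤ (2 * Real.pi) ^ 2 := by nlinarith [Real.pi_gt_three]
        nlinarith [sq_nonneg (k i : ℝ)]
      simp only [A]
      linarith
    calc (A ^ 2)⁻¹ = A ^ (-2 : ℝ) := by
          rw [Real.rpow_neg (by positivity), Real.rpow_two]
      _ ≤ A ^ ((-(2 / 3) : ℝ) * d) := by
          refine Real.rpow_le_rpow_of_exponent_le hA ?_
          have : (d : ℝ) ≤ 3 := by exact_mod_cast hd3
          linarith
      _ = ∏ _i : Fin d, A ^ (-(2 / 3) : ℝ) := by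
          rw [Finset.prod_const, Finset.card_univ, Fintype.card_fin,
            Real.rpow_mul (by positivity), Real.rpow_natCast]
      _ ≤ _ := Finset.prod_le_prod (fun _ _ => by positivity) fun i _ => hi i
  refine ne_top_of_le_ne_top ?_ hle
  rw [tsum_pi_prod fun n => ENNReal.ofReal (g n)]
  refine ENNReal.pow_ne_top ?_
  rw [← ENNReal.ofReal_tsum_of_nonneg hg0 hg]
  exact ENNReal.ofReal_ne_top

lemma tsum_inv_symb_sq_sub {d : ℕ} (k : Fin d → ℤ) :
    ∑' l, (symb (k - l) ^ 2)⁻¹ = latticeSum d :=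
  (Equiv.subLeft k).tsum_eq fun l => (symb l ^ 2)⁻¹

/-- Kernel bound for `tsum_mul_conv_sq_le` with `ρ = 1` and `τ = symb`, which maps `H¹ × H¹` into
`L²`. -/
lemma tsum_inv_symb_mul_le {d : ℕ} (k : Fin d → ℤ) :
    1 * ∑' l, (symb l)⁻¹ * (symb (k - l))⁻¹ ≤ 2 * latticeSum d := by
  rw [one_mul, two_mul]
  calc _ ≤ ∑' l, ((symb l ^ 2)⁻¹ + (symb (k - l) ^ 2)⁻¹) :=
        ENNReal.tsum_le_tsum fun l => by
          rw [ENNReal.inv_pow, ENNReal.inv_pow]; exact ennreal_mul_le_add_sq _ _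
    _ = _ := by rw [ENNReal.tsum_add, tsum_inv_symb_sq_sub, latticeSum]

/-- Kernel bound for the algebra property of `H²`: each term of `symb_sq_le` cancels one of the two
inverse weights, leaving a copy of the lattice sum. -/
lemma symb_sq_mul_tsum_le {d : ℕ} (k : Fin d → ℤ) :
    symb k ^ 2 * ∑' l, (symb l ^ 2)⁻¹ * (symb (k - l) ^ 2)⁻¹ ≤ 16 * latticeSum d := by
  rw [← ENNReal.tsum_mul_left]
  calc _ ≤ ∑' l, 8 * ((symb (k - l) ^ 2)⁻¹ + (symb l ^ 2)⁻¹) :=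
        ENNReal.tsum_le_tsum fun l => by
          refine (mul_le_mul_left (symb_sq_le k l) _).trans (le_of_eq ?_)
          rw [mul_assoc, add_mul, ← mul_assoc (symb l ^ 2),
            ENNReal.mul_inv_cancel (pow_ne_zero 2 (symb_ne_zero l))
              (ENNReal.pow_ne_top (symb_ne_top l)), one_mul, mul_left_comm,
            ENNReal.mul_inv_cancel (pow_ne_zero 2 (symb_ne_zero _))
              (ENNReal.pow_ne_top (symb_ne_top _)), mul_one]
    _ = 16 * latticeSum d := by
          rw [ENNReal.tsum_mul_left, ENNReal.tsum_add, tsum_inv_symb_sq_sub, ← latticeSum,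
            ← two_mul, ← mul_assoc]
          norm_num

/-! ### Fourier coefficients of complex-valued functions -/

open UnitAddTorus (mFourier mFourierCoeff mFourierLp)
open scoped ComplexConjugate

lemma mFourierCoeff_congr {d : ℕ} {f g : Torus d → ℂ} (h : f =ᵐ[torusMeasure d] g)
    (k : Fin d → ℤ) : mFourierCoeff f k = mFourierCoeff g k := by
  refine integral_congr_ae ?_
  filter_upwards [h] with x hx
  rw [hx]

lemma hasSum_conj_coeff_mul {d : ℕ} {f g : Torus d → ℂ} (hf : MemLp f 2 (torusMeasure d))
    (hg : MemLp g 2 (torusMeasure d)) :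
    HasSum (fun k => conj (mFourierCoeff f k) * mFourierCoeff g k)
      (∫ x, conj (f x) * g x ∂(torusMeasure d)) := by
  have h := UnitAddTorus.hasSum_prod_mFourierCoeff (d := Fin d) hf.toLp hg.toLp
  have e1 : ∀ k, mFourierCoeff (hf.toLp f) k = mFourierCoeff f k :=
    mFourierCoeff_congr hf.coeFn_toLp
  have e2 : ∀ k, mFourierCoeff (hg.toLp g) k = mFourierCoeff g k :=
    mFourierCoeff_congr hg.coeFn_toLp
  simp only [e1, e2] at h
  convert! h using 1
  refine integral_congr_ae ?_
  filter_upwards [hf.coeFn_toLp, hg.coeFn_toLp] with x h1 h2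
  rw [h1, h2]

/-- The squared Sobolev norm `∑ (1 + |G|²)ⁿ |ĝ(G)|²`. -/
def sobSq {d : ℕ} (n : ℕ) (g : Torus d → ℂ) : ℝ≥0∞ :=
  ∑' k, symb k ^ n * ‖mFourierCoeff g k‖ₑ ^ 2

lemma sobSq_congr {d : ℕ} {f g : Torus d → ℂ} (h : f =ᵐ[torusMeasure d] g) (n : ℕ) :
    sobSq n f = sobSq n g := by
  simp only [sobSq, mFourierCoeff_congr h]

lemma mFourierCoeff_add {d : ℕ} {f g : Torus d → ℂ} (hf : Integrable f (torusMeasure d))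
    (hg : Integrable g (torusMeasure d)) (k : Fin d → ℤ) :
    mFourierCoeff (f + g) k = mFourierCoeff f k + mFourierCoeff g k := by
  have hi : ∀ {h : Torus d → ℂ}, Integrable h (torusMeasure d) →
      Integrable (fun x => mFourier (-k) x • h x) (torusMeasure d) := fun hh =>
    hh.bdd_mul (c := ‖mFourier (-k)‖) (mFourier (-k)).continuous.aestronglyMeasurable
      (Filter.Eventually.of_forall fun x => (mFourier (-k)).norm_coe_le_norm x)
  refine Eq.trans ?_ (integral_add (hi hf) (hi hg))
  exact integral_congr_ae (Filter.Eventually.of_forall fun x => smul_add _ _ _)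

lemma sobSq_add_le {d : ℕ} (n : ℕ) {f g : Torus d → ℂ} (hf : Integrable f (torusMeasure d))
    (hg : Integrable g (torusMeasure d)) :
    sobSq n (f + g) ≤ 2 * (sobSq n f + sobSq n g) := by
  rw [sobSq, sobSq, sobSq, ← ENNReal.tsum_add, ← ENNReal.tsum_mul_left]
  refine ENNReal.tsum_le_tsum fun k => ?_
  rw [mFourierCoeff_add hf hg, ← mul_add, mul_left_comm]
  exact mul_le_mul_right ((pow_le_pow_left' (enorm_add_le _ _) 2).trans (ennreal_add_sq_le _ _)) _

/-- **Parseval's identity**. -/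
lemma sobSq_zero_eq {d : ℕ} {g : Torus d → ℂ} (hg : MemLp g 2 (torusMeasure d)) :
    sobSq 0 g = eLpNorm g 2 (torusMeasure d) ^ 2 := by
  have h := UnitAddTorus.hasSum_sq_mFourierCoeff (d := Fin d) hg.toLp
  have e1 : ∀ k, mFourierCoeff (hg.toLp g) k = mFourierCoeff g k :=
    mFourierCoeff_congr hg.coeFn_toLp
  simp only [e1] at h
  have e2 : sobSq 0 g = ENNReal.ofReal (∑' k, ‖mFourierCoeff g k‖ ^ 2) := by
    rw [ENNReal.ofReal_tsum_of_nonneg (fun _ => sq_nonneg _) h.summable]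
    refine tsum_congr fun k => ?_
    rw [pow_zero, one_mul, ← ofReal_norm, ENNReal.ofReal_pow (norm_nonneg _)]
  have e3 : eLpNorm g 2 (torusMeasure d) ^ 2 =
      ENNReal.ofReal (∫ t, ‖(hg.toLp g) t‖ ^ 2 ∂(torusMeasure d)) := by
    have := L2.inner_def (𝕜 := ℂ) hg.toLp hg.toLp
    have h2 : ∫ t, ‖(hg.toLp g) t‖ ^ 2 ∂(torusMeasure d) = ‖hg.toLp g‖ ^ 2 := by
      rw [← inner_self_eq_norm_sq (𝕜 := ℂ), L2.inner_def, ← integral_re (L2.integrable_inner _ _)]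
      simp only [inner_self_eq_norm_sq]
    rw [h2, Lp.norm_toLp, ENNReal.ofReal_pow ENNReal.toReal_nonneg,
      ENNReal.ofReal_toReal hg.eLpNorm_ne_top]
  rw [e2, e3, h.tsum_eq]
  rfl

lemma mFourier_mul_conj {d : ℕ} (k l : Fin d → ℤ) (x : Torus d) :
    mFourier (-l) x * mFourier k x = conj (mFourier (l - k) x) := by
  rw [← UnitAddTorus.mFourier_neg, ← UnitAddTorus.mFourier_add]
  congr 2
  abel

/-- The Fourier coefficients of a product are bounded by the convolution. -/
lemma enorm_coeff_mul_le {d : ℕ} {f g : Torus d → ℂ} (hf : MemLp f 2 (torusMeasure d))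
    (hg : MemLp g 2 (torusMeasure d)) (k : Fin d → ℤ) :
    ‖mFourierCoeff (f * g) k‖ₑ ≤ ∑' l, ‖mFourierCoeff f l‖ₑ * ‖mFourierCoeff g (k - l)‖ₑ := by
  -- With `h = e_k · conj f`, the pairing `∫ conj h · g` is the `k`-th coefficient of `f g`, while
  -- `ĥ(l)` is the conjugate of `f̂(k - l)`; Parseval turns the pairing into the convolution.
  set h : Torus d → ℂ := fun x => mFourier k x * conj (f x)
  have hh : MemLp h 2 (torusMeasure d) := by
    refine MemLp.of_le hf ((mFourier k).continuous.aestronglyMeasurable.mul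
      (Complex.continuous_conj.comp_aestronglyMeasurable hf.1)) ?_
    refine Filter.Eventually.of_forall fun x => ?_
    rw [norm_mul, RCLike.norm_conj]
    refine mul_le_of_le_one_left (norm_nonneg _) ?_
    exact ((mFourier k).norm_coe_le_norm x).trans UnitAddTorus.mFourier_norm.le
  have hc : ∀ l, mFourierCoeff h l = conj (mFourierCoeff f (k - l)) := by
    intro l
    refine Eq.trans ?_ integral_conj
    refine integral_congr_ae (Filter.Eventually.of_forall fun x => ?_)
    simp only [smul_eq_mul, h, map_mul]
    rw [← mul_assoc, mFourier_mul_conj, neg_sub]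
  have hs := hasSum_conj_coeff_mul hh hg
  have e : ∫ x, conj (h x) * g x ∂(torusMeasure d) = mFourierCoeff (f * g) k := by
    refine integral_congr_ae (Filter.Eventually.of_forall fun x => ?_)
    simp only [h, map_mul, Complex.conj_conj, ← UnitAddTorus.mFourier_neg, smul_eq_mul,
      Pi.mul_apply, mul_assoc]
  rw [e] at hs
  simp only [hc, Complex.conj_conj] at hs
  rw [← hs.tsum_eq, ← (Equiv.subLeft k).tsum_eq]
  refine (enorm_tsum_le_tsum_enorm).trans (le_of_eq ?_)
  refine tsum_congr fun l => ?_
  simp [enorm_mul]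

/-- `H²` is an algebra in dimension at most three. -/
lemma sobSq_two_mul_le {d : ℕ} {f g : Torus d → ℂ} (hf : MemLp f 2 (torusMeasure d))
    (hg : MemLp g 2 (torusMeasure d)) :
    sobSq 2 (f * g) ≤ 16 * latticeSum d * sobSq 2 f * sobSq 2 g := by
  refine le_trans (ENNReal.tsum_le_tsum fun k => ?_) (tsum_mul_conv_sq_le
    (fun k => symb k ^ 2) (fun k => symb k ^ 2) (16 * latticeSum d)
    (fun k => pow_ne_zero 2 (symb_ne_zero k)) (fun k => ENNReal.pow_ne_top (symb_ne_top k))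
    symb_sq_mul_tsum_le (fun l => ‖mFourierCoeff f l‖ₑ) fun l => ‖mFourierCoeff g l‖ₑ)
  exact mul_le_mul_right (pow_le_pow_left' (enorm_coeff_mul_le hf hg k) 2) _

/-- Used with `f = g`: bounding `g²` in `L²` is bounding `g` in `L⁴`. -/
lemma sobSq_zero_mul_le {d : ℕ} {f g : Torus d → ℂ} (hf : MemLp f 2 (torusMeasure d))
    (hg : MemLp g 2 (torusMeasure d)) :
    sobSq 0 (f * g) ≤ 2 * latticeSum d * sobSq 1 f * sobSq 1 g := by
  have h := tsum_mul_conv_sq_le (fun _ : Fin d → ℤ => 1) symb (2 * latticeSum d)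
    symb_ne_zero symb_ne_top tsum_inv_symb_mul_le
    (fun l => ‖mFourierCoeff f l‖ₑ) fun l => ‖mFourierCoeff g l‖ₑ
  simp only [sobSq, pow_one, pow_zero] at h ⊢
  refine le_trans (ENNReal.tsum_le_tsum fun k => ?_) h
  exact mul_le_mul_right (pow_le_pow_left' (enorm_coeff_mul_le hf hg k) 2) _

/-- Cauchy–Schwarz against the weight `symb`. Summability of the coefficients is what bounds the
supremum of the Fourier series. -/
lemma tsum_enorm_coeff_sq_le {d : ℕ} (g : Torus d → ℂ) :
    (∑' k, ‖mFourierCoeff g k‖ₑ) ^ 2 ≤ latticeSum d * sobSq 2 g := by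
  have h := ennreal_tsum_mul_sq_le (fun k : Fin d → ℤ => (symb k)⁻¹)
    fun k => symb k * ‖mFourierCoeff g k‖ₑ
  simp only [← mul_assoc, ENNReal.inv_mul_cancel (symb_ne_zero _) (symb_ne_top _), one_mul,
    mul_pow, ← ENNReal.inv_pow] at h
  exact h

/-! ### Partial Fourier sums and embeddings -/

/-- The partial Fourier sum of `g` over a finite set of frequencies. -/
def partialSum {d : ℕ} (g : Torus d → ℂ) (F : Finset (Fin d → ℤ)) : C(Torus d, ℂ) :=
  ∑ k ∈ F, mFourierCoeff g k • mFourier k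

lemma memLp_continuous {d : ℕ} (p : C(Torus d, ℂ)) (q : ℝ≥0∞) : MemLp p q (torusMeasure d) :=
  MemLp.of_bound p.continuous.aestronglyMeasurable ‖p‖
    (Filter.Eventually.of_forall p.norm_coe_le_norm)

lemma mFourierCoeff_eq_inner {d : ℕ} (p : C(Torus d, ℂ)) (k : Fin d → ℤ) :
    mFourierCoeff p k = inner ℂ (mFourierLp 2 k : Lp (α := Torus d) ℂ 2 (torusMeasure d))
      (ContinuousMap.toLp 2 (torusMeasure d) ℂ p) := by
  rw [← congrFun UnitAddTorus.coe_mFourierBasis k, ← HilbertBasis.repr_apply_apply,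
    UnitAddTorus.mFourierBasis_repr]
  exact (UnitAddTorus.mFourierCoeff_toLp p k).symm

lemma mFourierCoeff_mFourier {d : ℕ} (m k : Fin d → ℤ) :
    mFourierCoeff (mFourier m) k = if k = m then 1 else 0 := by
  rw [mFourierCoeff_eq_inner]
  exact orthonormal_iff_ite.1 UnitAddTorus.orthonormal_mFourier k m

lemma enorm_coeff_partialSum_le {d : ℕ} (g : Torus d → ℂ) (F : Finset (Fin d → ℤ))
    (k : Fin d → ℤ) : ‖mFourierCoeff (partialSum g F) k‖ₑ ≤ ‖mFourierCoeff g k‖ₑ := by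
  have e : mFourierCoeff (partialSum g F) k = if k ∈ F then mFourierCoeff g k else 0 := by
    rw [mFourierCoeff_eq_inner, partialSum, map_sum, inner_sum]
    simp only [map_smul, inner_smul_right, ← mFourierCoeff_eq_inner, mFourierCoeff_mFourier]
    simp
  rw [e]
  split_ifs <;> simp

/-- The partial sums converge in `L²`, hence almost everywhere along a subsequence, and Fatou's
lemma passes the bound to the limit. Embeddings therefore need proof only for trigonometric
polynomials. -/
lemma eLpNorm_le_of_partialSum {d : ℕ} {g : Torus d → ℂ} (hg : MemLp g 2 (torusMeasure d))
    {p C : ℝ≥0∞} (h : ∀ F, eLpNorm (partialSum g F) p (torusMeasure d) ≤ C) :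
    eLpNorm g p (torusMeasure d) ≤ C := by
  have h1 := UnitAddTorus.hasSum_mFourier_series_L2 (d := Fin d) hg.toLp
  have e1 : ∀ k, mFourierCoeff (hg.toLp g) k = mFourierCoeff g k :=
    mFourierCoeff_congr hg.coeFn_toLp
  simp only [e1] at h1
  have e2 : ∀ F : Finset (Fin d → ℤ),
      ∑ k ∈ F, mFourierCoeff g k • (mFourierLp 2 k : Lp (α := Torus d) ℂ 2 (torusMeasure d)) =
        ContinuousMap.toLp 2 (torusMeasure d) ℂ (partialSum g F) := fun F => by
    rw [partialSum, map_sum]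
    simp only [map_smul]
    rfl
  have h2 : Filter.Tendsto (fun F => (ContinuousMap.toLp 2 (torusMeasure d) ℂ (partialSum g F)))
      Filter.atTop (nhds (hg.toLp g)) := by
    simp only [← e2]
    exact h1
  obtain ⟨ns, -, hns⟩ := (tendstoInMeasure_of_tendsto_Lp h2).exists_seq_tendsto_ae'
  have hlim : ∀ᵐ x ∂(torusMeasure d),
      Filter.Tendsto (fun i => partialSum g (ns i) x) Filter.atTop (nhds (g x)) := by
    have hall : ∀ᵐ x ∂(torusMeasure d), ∀ i,
        ContinuousMap.toLp 2 (torusMeasure d) ℂ (partialSum g (ns i)) x = partialSum g (ns i) x :=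
      ae_all_iff.2 fun i => ContinuousMap.coeFn_toLp _ _
    filter_upwards [hns, hall, hg.coeFn_toLp] with x h3 h4 h5
    simp only [h4, h5] at h3
    exact h3
  refine (Lp.eLpNorm_lim_le_liminf_eLpNorm
    (fun i => (partialSum g (ns i)).continuous.aestronglyMeasurable) g hlim).trans ?_
  refine Filter.liminf_le_of_le (by isBoundedDefault) fun b hb => ?_
  obtain ⟨i, hi⟩ := hb.exists
  exact hi.trans (h _)

/-- The embedding of `H²` into the bounded functions. -/
lemma eLpNorm_top_sq_le {d : ℕ} {g : Torus d → ℂ} (hg : MemLp g 2 (torusMeasure d)) :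
    eLpNorm g ⊤ (torusMeasure d) ^ 2 ≤ latticeSum d * sobSq 2 g := by
  refine le_trans (pow_le_pow_left' (eLpNorm_le_of_partialSum hg
    (C := ∑' k, ‖mFourierCoeff g k‖ₑ) fun F => ?_) 2) (tsum_enorm_coeff_sq_le g)
  rw [eLpNorm_exponent_top]
  refine eLpNormEssSup_le_of_ae_enorm_bound (Filter.Eventually.of_forall fun x => ?_)
  rw [partialSum, ContinuousMap.sum_apply]
  refine (enorm_sum_le _ _).trans (le_trans (Finset.sum_le_sum fun k _ => ?_)
    (ENNReal.sum_le_tsum F))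
  rw [ContinuousMap.smul_apply, enorm_smul]
  refine mul_le_of_le_one_right' ?_
  rw [← ofReal_norm, ENNReal.ofReal_le_one]
  exact ((mFourier k).norm_coe_le_norm x).trans UnitAddTorus.mFourier_norm.le

lemma eLpNorm_sq_two {d : ℕ} (g : Torus d → ℂ) :
    eLpNorm (g * g) 2 (torusMeasure d) = eLpNorm g 4 (torusMeasure d) ^ 2 := by
  rw [eLpNorm_eq_lintegral_rpow_enorm_toReal (by norm_num) (by norm_num),
    eLpNorm_eq_lintegral_rpow_enorm_toReal (by norm_num) (by norm_num), ← ENNReal.rpow_natCast,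
    ← ENNReal.rpow_mul]
  congr 1
  · refine lintegral_congr fun x => ?_
    rw [Pi.mul_apply, enorm_mul]
    norm_num
    ring
  · norm_num

/-- The embedding of `H¹` into `L⁴` in dimension at most three. -/
lemma eLpNorm_four_le {d : ℕ} {g : Torus d → ℂ} (hg : MemLp g 2 (torusMeasure d)) :
    eLpNorm g 4 (torusMeasure d) ≤ (2 * latticeSum d * sobSq 1 g * sobSq 1 g) ^ (1 / 4 : ℝ) := by
  refine eLpNorm_le_of_partialSum hg fun F => ?_
  set s := partialSum g F
  have hs := memLp_continuous s 2
  have h1 : sobSq 1 s ≤ sobSq 1 g := ENNReal.tsum_le_tsum fun k =>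
    mul_le_mul_right (pow_le_pow_left' (enorm_coeff_partialSum_le g F k) 2) _
  -- The partial sum is continuous, so its square lies in `L²` and Parseval applies to it; this is
  -- not yet known for `g * g`.
  have h2 := sobSq_zero_mul_le hs hs
  rw [sobSq_zero_eq (g := (⇑s * ⇑s : Torus d → ℂ)) (memLp_continuous (s * s) 2), eLpNorm_sq_two,
    ← pow_mul] at h2
  rw [one_div, ENNReal.le_rpow_inv_iff (by norm_num)]
  refine le_trans (le_of_eq ?_) (h2.trans ?_)
  · rw [← ENNReal.rpow_natCast]; norm_num
  · gcongr

/-! ### Fourier modes and the weak gradient -/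

instance instIsProbabilityMeasureTorus (d : ℕ) : IsProbabilityMeasure (torusMeasure d) :=
  inferInstanceAs (IsProbabilityMeasure (Measure.pi fun _ : Fin d => AddCircle.haarAddCircle))

instance instIsAddLeftInvariantTorus (d : ℕ) : (torusMeasure d).IsAddLeftInvariant :=
  inferInstanceAs
    (Measure.pi fun _ : Fin d => (AddCircle.haarAddCircle (T := 1))).IsAddLeftInvariant

lemma mFourier_add_apply {d : ℕ} (k : Fin d → ℤ) (x y : Torus d) :
    mFourier k (x + y) = mFourier k x * mFourier k y := by
  simp only [mFourier, ContinuousMap.coe_mk, ← Finset.prod_mul_distrib, Pi.add_apply]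
  refine Finset.prod_congr rfl fun i _ => ?_
  simp only [fourier_apply, smul_add, AddCircle.toCircle_add, Circle.coe_mul]

/-- The Fourier multiplier `i Gⱼ` of the `j`-th partial derivative. -/
def freq {d : ℕ} (k : Fin d → ℤ) (j : Fin d) : ℂ := 2 * Real.pi * Complex.I * k j

lemma freq_neg {d : ℕ} (k : Fin d → ℤ) (j : Fin d) : freq (-k) j = -freq k j := by
  simp [freq]

lemma norm_freq_sq {d : ℕ} (k : Fin d → ℤ) (j : Fin d) :
    ‖freq k j‖ ^ 2 = (2 * Real.pi * (k j : ℝ)) ^ 2 := by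
  simp [freq, mul_pow]

lemma mFourier_single_coe {d : ℕ} (k : Fin d → ℤ) (j : Fin d) (h : ℝ) :
    mFourier k (Pi.single j (h : AddCircle (1 : ℝ))) = Complex.exp (freq k j * h) := by
  simp only [mFourier, ContinuousMap.coe_mk]
  rw [Finset.prod_eq_single j]
  · rw [Pi.single_eq_same, fourier_coe_apply]
    simp [freq]
  · intro i _ hi
    rw [Pi.single_eq_of_ne hi, fourier_eval_zero]
  · simp

lemma mFourier_add_single {d : ℕ} (k : Fin d → ℤ) (j : Fin d) (x : Torus d) (h : ℝ) :
    mFourier k (x + Pi.single j (h : AddCircle (1 : ℝ))) =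
      mFourier k x * Complex.exp (freq k j * h) := by
  rw [mFourier_add_apply, mFourier_single_coe]

lemma norm_mFourier_apply {d : ℕ} (k : Fin d → ℤ) (x : Torus d) : ‖mFourier k x‖ = 1 := by
  simp only [mFourier, ContinuousMap.coe_mk, norm_prod, fourier_apply, Circle.norm_coe,
    Finset.prod_const_one]

lemma hasDerivAt_mFourier {d : ℕ} (k : Fin d → ℤ) (j : Fin d) (x : Torus d) :
    HasDerivAt (fun h : ℝ => mFourier k (x + Pi.single j (h : AddCircle (1 : ℝ))))
      (freq k j * mFourier k x) 0 := by
  simp only [mFourier_add_single]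
  have h1 : HasDerivAt (fun h : ℝ => freq k j * (h : ℂ)) (freq k j) 0 := by
    simpa using (Complex.ofRealCLM.hasDerivAt (x := 0)).const_mul (freq k j)
  have h2 := (h1.cexp).const_mul (mFourier k x)
  simp only [Complex.ofReal_zero, mul_zero, Complex.exp_zero, one_mul] at h2
  rwa [mul_comm (freq k j)]

/-- The real-valued Fourier mode `Re (c e_G)`. -/
def modeFn {d : ℕ} (c : ℂ) (k : Fin d → ℤ) : C(Torus d, ℝ) :=
  ⟨fun x => (c * mFourier k x).re, by fun_prop⟩

lemma modeFn_apply {d : ℕ} (c : ℂ) (k : Fin d → ℤ) (x : Torus d) :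
    modeFn c k x = (c * mFourier k x).re := rfl

lemma isSmooth_modeFn {d : ℕ} (c : ℂ) (k : Fin d → ℤ) : IsSmooth (modeFn c k) :=
  Complex.reCLM.contDiff.comp (contDiff_const.mul (isSmooth_mFourier k))

lemma partialDeriv_modeFn {d : ℕ} (c : ℂ) (k : Fin d → ℤ) (j : Fin d) (x : Torus d) :
    partialDeriv j (modeFn c k) x = modeFn (c * freq k j) k x := by
  refine HasDerivAt.deriv ?_
  have h := Complex.reCLM.hasFDerivAt.comp_hasDerivAt (0 : ℝ)
    ((hasDerivAt_mFourier k j x).const_mul c)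
  rw [modeFn_apply, mul_assoc]
  exact h

lemma integral_mul_modeFn {d : ℕ} (u : L2 d) (c : ℂ) (k : Fin d → ℤ) :
    ∫ x, u x * modeFn c k x ∂(torusMeasure d) = (c * coeff u (-k)).re := by
  have hi := (integrable_coeff u (-k)).const_mul c
  have h := Complex.reCLM.integral_comp_comm hi
  rw [integral_const_mul] at h
  refine Eq.trans (integral_congr_ae (Filter.Eventually.of_forall fun x => ?_)) h
  simp only [modeFn_apply, neg_neg, smul_eq_mul, Complex.reCLM_apply, ← mul_assoc]
  rw [Complex.re_mul_ofReal, mul_comm]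

lemma IsWeakPartial.coeff_eq {d : ℕ} {j : Fin d} {u g : L2 d} (h : IsWeakPartial j u g)
    (k : Fin d → ℤ) : coeff g k = freq k j * coeff u k := by
  -- Test functions are the real modes `Re (c e_{-k})`; `c = 1` and `c = -i` then recover the real
  -- and imaginary parts.
  have key : ∀ c : ℂ, (c * coeff g k).re = (c * (freq k j * coeff u k)).re := by
    intro c
    have h1 := h (modeFn c (-k)) (isSmooth_modeFn c (-k))
    simp only [partialDeriv_modeFn] at h1
    rw [integral_mul_modeFn, integral_mul_modeFn, freq_neg, neg_neg] at h1
    rw [← mul_assoc]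
    simp only [mul_neg, neg_mul, Complex.neg_re] at h1
    linarith
  refine Complex.ext (by simpa using key 1) ?_
  simpa using key (-Complex.I)

lemma H1.coeff_grad {d : ℕ} (u : H1 d) (j : Fin d) (k : Fin d → ℤ) :
    coeff (u.grad j) k = freq k j * coeff u.fn k := IsWeakPartial.coeff_eq (u.2 j) k

/-! ### Translations -/

/-- Translation of square-integrable functions: `x ↦ u (x + h)`. -/
def shift {d : ℕ} (h : Torus d) (u : L2 d) : L2 d :=
  Lp.compMeasurePreserving (fun x => x + h) (measurePreserving_add_right _ h) u

lemma coeFn_shift {d : ℕ} (h : Torus d) (u : L2 d) :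
    shift h u =ᵐ[torusMeasure d] fun x => u (x + h) :=
  Lp.coeFn_compMeasurePreserving u (measurePreserving_add_right _ h)

lemma integral_add_right_torus {d : ℕ} {E : Type*} [NormedAddCommGroup E] [NormedSpace ℝ E]
    (h : Torus d) (f : Torus d → E) :
    ∫ x, f (x + h) ∂(torusMeasure d) = ∫ x, f x ∂(torusMeasure d) :=
  integral_add_right_eq_self f h

lemma coeff_shift {d : ℕ} (h : Torus d) (u : L2 d) (k : Fin d → ℤ) :
    coeff (shift h u) k = mFourier k h * coeff u k := by
  have e1 : coeff (shift h u) k =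
      ∫ x, (mFourier k h * mFourier (-k) (x + h)) * (u (x + h) : ℂ) ∂(torusMeasure d) := by
    refine integral_congr_ae ?_
    filter_upwards [coeFn_shift h u] with x hx
    have h1 : mFourier k h * mFourier (-k) h = 1 := by
      rw [← UnitAddTorus.mFourier_add, add_neg_cancel, UnitAddTorus.mFourier_zero]; rfl
    rw [hx, smul_eq_mul, mFourier_add_apply, mul_left_comm, h1, mul_one]
  rw [e1, integral_add_right_torus h fun x => mFourier k h * mFourier (-k) x * (u x : ℂ)]
  simp only [mul_assoc, integral_const_mul]
  rfl

lemma IsSmooth.comp_add {d : ℕ} {φ : Torus d → ℝ} (hφ : IsSmooth φ) (h : Torus d) :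
    IsSmooth fun x => φ (x + h) := by
  obtain ⟨y, rfl⟩ := (proj_isOpenQuotientMap d).surjective h
  exact ContDiff.comp (g := fun x : Fin d → ℝ => φ (proj d x)) hφ
    (contDiff_id.add (contDiff_const (c := y)))

lemma partialDeriv_comp_add {d : ℕ} (j : Fin d) (φ : Torus d → ℝ) (h x : Torus d) :
    partialDeriv j (fun y => φ (y + h)) x = partialDeriv j φ (x + h) := by
  unfold partialDeriv
  simp only [add_right_comm]

lemma integral_shift_mul {d : ℕ} (h : Torus d) (u : L2 d) (φ : Torus d → ℝ) :
    ∫ x, shift h u x * φ x ∂(torusMeasure d) = ∫ x, u x * φ (x + -h) ∂(torusMeasure d) := by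
  rw [← integral_add_right_torus h fun x => u x * φ (x + -h)]
  refine integral_congr_ae ?_
  filter_upwards [coeFn_shift h u] with x hx
  rw [hx, add_neg_cancel_right]

lemma IsWeakPartial.shift {d : ℕ} {j : Fin d} {u g : L2 d} (hu : IsWeakPartial j u g)
    (h : Torus d) : IsWeakPartial j (shift h u) (shift h g) := by
  intro φ hφ
  rw [integral_shift_mul, integral_shift_mul]
  simp only [← partialDeriv_comp_add]
  exact hu _ (hφ.comp_add (-h))

/-- Build an element of `H¹` from a function and its weak gradient. -/
def H1.mk {d : ℕ} (u : L2 d) (g : Fin d → L2 d) (h : ∀ j, IsWeakPartial j u (g j)) : H1 d :=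
  ⟨WithLp.toLp 2 (u, WithLp.toLp 2 g), h⟩

/-- Translation on `H¹`. -/
def H1.shift {d : ℕ} (h : Torus d) (u : H1 d) : H1 d :=
  H1.mk (FourierGP.shift h u.fn) (fun j => FourierGP.shift h (u.grad j))
    fun j => IsWeakPartial.shift (u.2 j) h

@[simp] lemma H1.fn_mk {d : ℕ} (u : L2 d) (g : Fin d → L2 d)
    (h : ∀ j, IsWeakPartial j u (g j)) : (H1.mk u g h).fn = u := rfl

@[simp] lemma H1.grad_mk {d : ℕ} (u : L2 d) (g : Fin d → L2 d)
    (h : ∀ j, IsWeakPartial j u (g j)) : (H1.mk u g h).grad = g := rfl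

@[simp] lemma H1.fn_shift {d : ℕ} (h : Torus d) (u : H1 d) :
    (u.shift h).fn = FourierGP.shift h u.fn := rfl

@[simp] lemma H1.fn_add {d : ℕ} (u v : H1 d) : (u + v).fn = u.fn + v.fn := rfl
@[simp] lemma H1.fn_sub {d : ℕ} (u v : H1 d) : (u - v).fn = u.fn - v.fn := rfl
@[simp] lemma H1.fn_smul {d : ℕ} (c : ℝ) (u : H1 d) : (c • u).fn = c • u.fn := rfl
@[simp] lemma H1.grad_add {d : ℕ} (u v : H1 d) (j : Fin d) :
    (u + v).grad j = u.grad j + v.grad j := rfl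
@[simp] lemma H1.grad_sub {d : ℕ} (u v : H1 d) (j : Fin d) :
    (u - v).grad j = u.grad j - v.grad j := rfl
@[simp] lemma H1.grad_smul {d : ℕ} (c : ℝ) (u : H1 d) (j : Fin d) :
    (c • u).grad j = c • u.grad j := rfl

lemma trigPoly_comp_add {d N : ℕ} {p : C(Torus d, ℂ)} (hp : p ∈ trigPoly d N) (h : Torus d) :
    ∃ q ∈ trigPoly d N, ∀ x, q x = p (x + h) := by
  induction hp using Submodule.span_induction with
  | mem p hp =>
    obtain ⟨k, hk, rfl⟩ := hp
    refine ⟨mFourier k h • mFourier k,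
      Submodule.smul_mem _ _ (Submodule.subset_span ⟨k, hk, rfl⟩), fun x => ?_⟩
    rw [mFourier_add_apply, mul_comm]
    rfl
  | zero => exact ⟨0, Submodule.zero_mem _, fun x => rfl⟩
  | add p q _ _ h1 h2 =>
    obtain ⟨p', hp', hp''⟩ := h1
    obtain ⟨q', hq', hq''⟩ := h2
    exact ⟨p' + q', Submodule.add_mem _ hp' hq', fun x => by simp [hp'', hq'']⟩
  | smul c p _ h1 =>
    obtain ⟨p', hp', hp''⟩ := h1
    exact ⟨c • p', Submodule.smul_mem _ _ hp', fun x => by simp [hp'']⟩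

/-- Translating a mode only multiplies it by a scalar. This invariance keeps second differences in
`X_N`, so the regularity argument runs on the discrete space with constants free of `N`. -/
lemma shift_mem_fourierSpace {d N : ℕ} {u : H1 d} (hu : u ∈ fourierSpace d N) (h : Torus d) :
    u.shift h ∈ fourierSpace d N := by
  obtain ⟨p, hp, hup⟩ := hu
  obtain ⟨q, hq, hqp⟩ := trigPoly_comp_add hp h
  refine ⟨q, hq, ?_⟩
  have h2 := (measurePreserving_add_right (torusMeasure d) h).quasiMeasurePreserving.ae hup
  filter_upwards [coeFn_shift h u.fn, h2] with x h3 h4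
  rw [H1.fn_shift, h3, h4, hqp]

/-! ### Real Fourier modes belong to `X_N` -/

lemma IsSmooth.hasDerivAt {d : ℕ} {φ : Torus d → ℝ} (hφ : IsSmooth φ) (j : Fin d) (x : Torus d)
    (h : ℝ) : HasDerivAt (fun t : ℝ => φ (x + Pi.single j (t : AddCircle (1 : ℝ))))
      (partialDeriv j φ (x + Pi.single j (h : AddCircle (1 : ℝ)))) h := by
  obtain ⟨y, rfl⟩ := (proj_isOpenQuotientMap d).surjective x
  have e : ∀ t : ℝ, proj d y + Pi.single j (t : AddCircle (1 : ℝ)) =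
      proj d (y + t • Pi.single j (1 : ℝ)) := by
    intro t
    funext i
    rcases eq_or_ne i j with rfl | hij
    · simp [proj]
    · simp [proj, Pi.single_eq_of_ne hij]
  simp only [e, partialDeriv_proj hφ]
  have hd : HasFDerivAt (fun y : Fin d → ℝ => φ (proj d y)) _ (y + h • Pi.single j (1 : ℝ)) :=
    ((ContDiff.differentiable hφ (by simp)) _).hasFDerivAt
  have h1 : HasDerivAt (fun t : ℝ => y + t • (Pi.single j (1 : ℝ) : Fin d → ℝ))
      (Pi.single j 1) h := by
    simpa using ((hasDerivAt_id h).smul_const (Pi.single j (1 : ℝ) : Fin d → ℝ)).const_add y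
  exact hd.comp_hasDerivAt h h1

/-- Integration by parts against a Fourier mode. -/
lemma integral_mFourier_mul_partialDeriv {d : ℕ} (k : Fin d → ℤ) (j : Fin d)
    {φ : Torus d → ℝ} (hφ : IsSmooth φ) :
    ∫ x, mFourier k x * (partialDeriv j φ x : ℂ) ∂(torusMeasure d) =
      -freq k j * ∫ x, mFourier k x * (φ x : ℂ) ∂(torusMeasure d) := by
  obtain ⟨C, hC⟩ := isCompact_univ.exists_bound_of_continuousOn
    (hφ.continuous_partialDeriv j).continuousOn
  set s : ℝ → Torus d := fun t => Pi.single j (t : AddCircle (1 : ℝ))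
  have hc : ∀ t, Continuous fun x => mFourier k x * (φ (x + s t) : ℂ) := fun t =>
    (mFourier k).continuous.mul (Complex.continuous_ofReal.comp
      (hφ.continuous.comp (continuous_id.add continuous_const)))
  have hc' : Continuous fun x => mFourier k x * (partialDeriv j φ (x + s 0) : ℂ) :=
    (mFourier k).continuous.mul (Complex.continuous_ofReal.comp
      ((hφ.continuous_partialDeriv j).comp (continuous_id.add continuous_const)))
  have hint : ∀ {f : Torus d → ℂ}, Continuous f → Integrable f (torusMeasure d) := fun {f} hf =>
    (memLp_continuous ⟨f, hf⟩ 1).integrable le_rfl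
  -- The derivative at `t = 0` of `∫ e_k(x) φ(x + t e_j)` is computed twice: under the integral
  -- sign, and after translating `x`, which moves `t` into a factor `exp(-freq k j * t)`.
  have h1 := (hasDerivAt_integral_of_dominated_loc_of_deriv_le (μ := torusMeasure d)
    (F := fun t x => mFourier k x * (φ (x + s t) : ℂ))
    (F' := fun t x => mFourier k x * (partialDeriv j φ (x + s t) : ℂ))
    (bound := fun _ => C) (x₀ := (0 : ℝ)) Filter.univ_mem
    (Filter.Eventually.of_forall fun t => (hc t).aestronglyMeasurable) (hint (hc 0))
    hc'.aestronglyMeasurable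
    (Filter.Eventually.of_forall fun x t _ => by
      rw [norm_mul, norm_mFourier_apply, one_mul, Complex.norm_real]
      exact hC _ (Set.mem_univ _))
    (integrable_const C)
    (Filter.Eventually.of_forall fun x t _ =>
      ((hφ.hasDerivAt j x t).ofReal_comp).const_mul (mFourier k x))).2
  have e : ∀ t, ∫ x, mFourier k x * (φ (x + s t) : ℂ) ∂(torusMeasure d) =
      Complex.exp (-freq k j * t) * ∫ x, mFourier k x * (φ x : ℂ) ∂(torusMeasure d) := by
    intro t
    rw [← integral_add_right_torus (s t) fun x => mFourier k x * (φ x : ℂ), ← integral_const_mul]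
    refine integral_congr_ae (Filter.Eventually.of_forall fun x => ?_)
    simp only [s, mFourier_add_single]
    rw [← mul_assoc, mul_left_comm, ← Complex.exp_add]
    simp
  simp only [e] at h1
  have h2 : HasDerivAt (fun t : ℝ => Complex.exp (-freq k j * t) *
      ∫ x, mFourier k x * (φ x : ℂ) ∂(torusMeasure d))
      (-freq k j * ∫ x, mFourier k x * (φ x : ℂ) ∂(torusMeasure d)) 0 := by
    have h3 : HasDerivAt (fun h : ℝ => -freq k j * (h : ℂ)) (-freq k j) 0 := by
      simpa using (Complex.ofRealCLM.hasDerivAt (x := 0)).const_mul (-freq k j)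
    simpa using h3.cexp.mul_const (∫ x, mFourier k x * (φ x : ℂ) ∂(torusMeasure d))
  have h3 := h1.unique h2
  have h0 : s 0 = 0 := by simp [s]
  simpa [h0] using h3

lemma integral_modeFn_mul {d : ℕ} (c : ℂ) (k : Fin d → ℤ) {φ : Torus d → ℝ}
    (hφ : Continuous φ) :
    ∫ x, modeFn c k x * φ x ∂(torusMeasure d) =
      (c * ∫ x, mFourier k x * (φ x : ℂ) ∂(torusMeasure d)).re := by
  have hcont : Continuous fun x => mFourier k x * (φ x : ℂ) :=
    (mFourier k).continuous.mul (Complex.continuous_ofReal.comp hφ)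
  have hi : Integrable (fun x => c * (mFourier k x * (φ x : ℂ))) (torusMeasure d) :=
    ((memLp_continuous ⟨_, hcont⟩ 1).integrable le_rfl).const_mul c
  have h := Complex.reCLM.integral_comp_comm hi
  rw [integral_const_mul] at h
  refine Eq.trans (integral_congr_ae (Filter.Eventually.of_forall fun x => ?_)) h
  simp only [modeFn_apply, Complex.reCLM_apply, ← mul_assoc]
  rw [Complex.re_mul_ofReal]

/-- A real Fourier mode as an element of `L²`. -/
def modeL2 {d : ℕ} (c : ℂ) (k : Fin d → ℤ) : L2 d :=
  ContinuousMap.toLp 2 (torusMeasure d) ℝ (modeFn c k)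

lemma coeFn_modeL2 {d : ℕ} (c : ℂ) (k : Fin d → ℤ) :
    modeL2 c k =ᵐ[torusMeasure d] modeFn c k := ContinuousMap.coeFn_toLp _ _

lemma isWeakPartial_modeL2 {d : ℕ} (c : ℂ) (k : Fin d → ℤ) (j : Fin d) :
    IsWeakPartial j (modeL2 c k) (modeL2 (c * freq k j) k) := by
  intro φ hφ
  have e : ∀ (b : ℂ) (ψ : Torus d → ℝ), ∫ x, modeL2 b k x * ψ x ∂(torusMeasure d) =
      ∫ x, modeFn b k x * ψ x ∂(torusMeasure d) := fun b ψ => by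
    refine integral_congr_ae ?_
    filter_upwards [coeFn_modeL2 b k] with x hx
    rw [hx]
  rw [e, e, integral_modeFn_mul _ _ (hφ.continuous_partialDeriv j),
    integral_modeFn_mul _ _ hφ.continuous, integral_mFourier_mul_partialDeriv k j hφ,
    ← Complex.neg_re]
  congr 1
  ring

/-- A real Fourier mode as an element of `H¹`. -/
def H1.mode {d : ℕ} (c : ℂ) (k : Fin d → ℤ) : H1 d :=
  H1.mk (modeL2 c k) (fun j => modeL2 (c * freq k j) k) (isWeakPartial_modeL2 c k)

lemma waveNumber_neg {d : ℕ} (k : Fin d → ℤ) : waveNumber (-k) = waveNumber k := by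
  simp [waveNumber]

lemma mode_mem_fourierSpace {d N : ℕ} (c : ℂ) {k : Fin d → ℤ}
    (hk : waveNumber k ≤ 2 * Real.pi * N) : H1.mode c k ∈ fourierSpace d N := by
  refine ⟨(c / 2) • mFourier k + (conj c / 2) • mFourier (-k), Submodule.add_mem _
    (Submodule.smul_mem _ _ (Submodule.subset_span ⟨k, hk, rfl⟩))
    (Submodule.smul_mem _ _ (Submodule.subset_span ⟨-k, ?_, rfl⟩)), ?_⟩
  · rwa [Set.mem_ofPred_eq, waveNumber_neg]
  · filter_upwards [coeFn_modeL2 c k] with x hx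
    rw [H1.mode, H1.fn_mk, hx, modeFn_apply, Complex.re_eq_add_conj, ContinuousMap.add_apply,
      ContinuousMap.smul_apply, ContinuousMap.smul_apply, UnitAddTorus.mFourier_neg, map_mul,
      smul_eq_mul, smul_eq_mul]
    ring

lemma inner_mode {d : ℕ} (u : H1 d) (c : ℂ) (k : Fin d → ℤ) :
    inner ℝ u (H1.mode c k) = (c * coeff u.fn (-k)).re * (1 + waveNumber k ^ 2) := by
  have e : ∀ (v : L2 d) (b : ℂ), ∫ x, v x * modeL2 b k x ∂(torusMeasure d) =
      (b * coeff v (-k)).re := fun v b => by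
    rw [← integral_mul_modeFn]
    refine integral_congr_ae ?_
    filter_upwards [coeFn_modeL2 b k] with x hx
    rw [hx]
  rw [H1.inner_eq, H1.mode, H1.fn_mk, H1.grad_mk, e, mul_add, mul_one, waveNumber_sq,
    Finset.mul_sum]
  congr 1
  refine Finset.sum_congr rfl fun j _ => ?_
  rw [e, H1.coeff_grad, freq_neg]
  have h : c * freq k j * (-freq k j * coeff u.fn (-k)) =
      c * coeff u.fn (-k) * (((2 * Real.pi * (k j : ℝ)) ^ 2 : ℝ) : ℂ) := by
    have : freq k j * freq k j = -(((2 * Real.pi * (k j : ℝ)) ^ 2 : ℝ) : ℂ) := by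
      simp only [freq]
      push_cast
      linear_combination (2 * Real.pi * k j : ℂ) ^ 2 * Complex.I_sq
    linear_combination (-c * coeff u.fn (-k)) * this
  rw [h, Complex.re_mul_ofReal]

/-- The projection error has no Fourier modes with `|G| ≤ 2πN`. -/
lemma coeff_sub_projN {d N : ℕ} (u : H1 d) {k : Fin d → ℤ}
    (hk : waveNumber k ≤ 2 * Real.pi * N) : coeff (u - projN d N u).fn k = 0 := by
  set w := u - projN d N u
  -- Amplitude and frequency are chosen so that the inner product equals `|ŵ(k)|² (1 + |G|²)`.
  have h : inner ℝ w (H1.mode (conj (coeff w.fn k)) (-k)) = 0 :=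
    Submodule.starProjection_inner_eq_zero u _
      (mode_mem_fourierSpace _ (by rwa [waveNumber_neg]))
  rw [inner_mode, neg_neg, mul_eq_zero] at h
  have h2 : 1 + waveNumber (-k) ^ 2 ≠ 0 := by positivity
  have h3 := h.resolve_right h2
  rw [mul_comm, Complex.mul_conj, Complex.ofReal_re, Complex.normSq_eq_zero] at h3
  exact h3

lemma projN_mem {d N : ℕ} (u : H1 d) : projN d N u ∈ fourierSpace d N :=
  Submodule.starProjection_apply_mem _ _

/-! ### Parseval's identity for real-valued functions -/

/-- The squared Sobolev norm of a real-valued function. -/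
def rsob {d : ℕ} (n : ℕ) (u : Torus d → ℝ) : ℝ≥0∞ := sobSq n fun x => (u x : ℂ)

lemma rsob_congr {d : ℕ} {u v : Torus d → ℝ} (h : u =ᵐ[torusMeasure d] v) (n : ℕ) :
    rsob n u = rsob n v :=
  sobSq_congr (by filter_upwards [h] with x hx; rw [hx]) n

lemma rsob_eq {d : ℕ} (n : ℕ) (u : L2 d) : rsob n u = ∑' k, symb k ^ n * ‖coeff u k‖ₑ ^ 2 := rfl

lemma L2.inner_eq_integral {d : ℕ} (u v : L2 d) :
    inner ℝ u v = ∫ x, u x * v x ∂(torusMeasure d) := by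
  simp [MeasureTheory.L2.inner_def, mul_comm]

lemma hasSum_inner {d : ℕ} (u v : L2 d) :
    HasSum (fun k => (conj (coeff u k) * coeff v k).re) (inner ℝ u v) := by
  have h := Complex.hasSum_re (hasSum_conj_coeff_mul (Lp.memLp u).ofReal (Lp.memLp v).ofReal)
  convert! h using 1
  rw [L2.inner_eq_integral, ← Complex.ofReal_re (∫ x, u x * v x ∂(torusMeasure d)),
    ← integral_complex_ofReal]
  simp

lemma re_conj_mul_self (z : ℂ) : (conj z * z).re = ‖z‖ ^ 2 := by
  rw [mul_comm, Complex.mul_conj, Complex.ofReal_re, Complex.normSq_eq_norm_sq]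

lemma hasSum_norm_sq {d : ℕ} (u : L2 d) : HasSum (fun k => ‖coeff u k‖ ^ 2) (‖u‖ ^ 2) := by
  have h := hasSum_inner u u
  simpa only [re_conj_mul_self, real_inner_self_eq_norm_sq] using h

lemma hasSum_inner_grad {d : ℕ} (u v : H1 d) :
    HasSum (fun k => waveNumber k ^ 2 * (conj (coeff u.fn k) * coeff v.fn k).re)
      (∑ j, inner ℝ (u.grad j) (v.grad j)) := by
  have h := hasSum_sum (s := Finset.univ) fun j _ => hasSum_inner (u.grad j) (v.grad j)
  convert! h using 1
  funext k
  rw [waveNumber_sq, Finset.sum_mul]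
  refine Finset.sum_congr rfl fun j _ => ?_
  rw [H1.coeff_grad, H1.coeff_grad, map_mul]
  have e : conj (freq k j) * conj (coeff u.fn k) * (freq k j * coeff v.fn k) =
      (((2 * Real.pi * (k j : ℝ)) ^ 2 : ℝ) : ℂ) * (conj (coeff u.fn k) * coeff v.fn k) := by
    rw [← norm_freq_sq, ← Complex.normSq_eq_norm_sq, ← Complex.mul_conj]
    ring
  rw [e, Complex.re_ofReal_mul]

lemma H1.norm_sq_eq {d : ℕ} (u : H1 d) : ‖u‖ ^ 2 = ‖u.fn‖ ^ 2 + ∑ j, ‖u.grad j‖ ^ 2 := by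
  rw [← real_inner_self_eq_norm_sq, H1.inner_eq, ← L2.inner_eq_integral,
    real_inner_self_eq_norm_sq]
  simp only [← L2.inner_eq_integral, real_inner_self_eq_norm_sq]

lemma H1.hasSum_norm_sq {d : ℕ} (u : H1 d) :
    HasSum (fun k => (1 + waveNumber k ^ 2) * ‖coeff u.fn k‖ ^ 2) (‖u‖ ^ 2) := by
  have h := (FourierGP.hasSum_norm_sq u.fn).add (hasSum_inner_grad u u)
  simp only [re_conj_mul_self, real_inner_self_eq_norm_sq] at h
  rw [H1.norm_sq_eq]
  simpa only [add_mul, one_mul] using h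

lemma enorm_sq_eq (z : ℂ) : ‖z‖ₑ ^ 2 = ENNReal.ofReal (‖z‖ ^ 2) := by
  rw [← ofReal_norm, ENNReal.ofReal_pow (norm_nonneg _)]

lemma rsob_eq_ofReal {d : ℕ} {n : ℕ} {u : L2 d} {a : ℝ}
    (h : HasSum (fun k => (1 + waveNumber k ^ 2) ^ n * ‖coeff u k‖ ^ 2) a) :
    rsob n u = ENNReal.ofReal a := by
  rw [rsob_eq, ← h.tsum_eq, ENNReal.ofReal_tsum_of_nonneg (fun _ => by positivity) h.summable]
  refine tsum_congr fun k => ?_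
  rw [enorm_sq_eq, symb, ← ENNReal.ofReal_pow (by positivity),
    ← ENNReal.ofReal_mul (by positivity)]

lemma H1.rsob_one {d : ℕ} (u : H1 d) : rsob 1 u.fn = ENNReal.ofReal (‖u‖ ^ 2) :=
  rsob_eq_ofReal (by simpa only [pow_one] using u.hasSum_norm_sq)

lemma rsob_le_ofReal {d : ℕ} {n : ℕ} {u : L2 d} {a : ℝ}
    (h : ∀ F : Finset (Fin d → ℤ),
      ∑ k ∈ F, (1 + waveNumber k ^ 2) ^ n * ‖coeff u k‖ ^ 2 ≤ a) :
    rsob n u ≤ ENNReal.ofReal a := by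
  have hs := summable_of_sum_le (fun _ => by positivity) h
  rw [rsob_eq_ofReal hs.hasSum]
  exact ENNReal.ofReal_le_ofReal (hs.tsum_le_of_sum_le h)

lemma rsob_ne_top_of_memSobolev {d : ℕ} {s : ℝ} {n : ℕ} (hn : (n : ℝ) ≤ s) {u : L2 d}
    (hu : MemSobolev s u) : rsob n u ≠ ⊤ := by
  have hs : Summable fun k => (1 + waveNumber k ^ 2) ^ n * ‖coeff u k‖ ^ 2 := by
    refine hu.of_nonneg_of_le (fun k => by positivity) fun k => ?_
    refine mul_le_mul_of_nonneg_right ?_ (by positivity)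
    rw [← Real.rpow_natCast]
    exact Real.rpow_le_rpow_of_exponent_le (by linarith [sq_nonneg (waveNumber k)]) hn
  rw [rsob_eq_ofReal hs.hasSum]
  exact ENNReal.ofReal_ne_top

/-! ### Regularity by difference quotients -/

/-- The second difference `2u - u(· + s) - u(· - s)`. -/
def secondDiff {d : ℕ} (s : Torus d) (u : H1 d) : H1 d :=
  (2 : ℝ) • u - u.shift s - u.shift (-s)

lemma coeff_sub {d : ℕ} (u v : L2 d) (k : Fin d → ℤ) :
    coeff (u - v) k = coeff u k - coeff v k := by
  rw [eq_sub_iff_add_eq, ← coeff_add, sub_add_cancel]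

/-- For `|z| = 1`, `2 - z - z̄ = |z - 1|²`. The symmetric difference is used because this multiplier
is real and nonnegative, so pairing `u` with its second difference gives a sum of nonnegative terms.
-/
lemma coeff_secondDiff {d : ℕ} (s : Torus d) (u : H1 d) (k : Fin d → ℤ) :
    coeff (secondDiff s u).fn k = ((‖mFourier k s - 1‖ ^ 2 : ℝ) : ℂ) * coeff u.fn k := by
  have h1 : mFourier k (-s) = conj (mFourier k s) := by
    rw [← UnitAddTorus.mFourier_neg]
    simp [mFourier]
  have h2 : conj (mFourier k s) * mFourier k s = 1 := by
    rw [mul_comm, Complex.mul_conj, Complex.normSq_eq_norm_sq, norm_mFourier_apply]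
    simp
  rw [secondDiff, H1.fn_sub, H1.fn_sub, H1.fn_smul, H1.fn_shift, H1.fn_shift, coeff_sub, coeff_sub,
    coeff_smul, coeff_shift, coeff_shift, h1, ← Complex.normSq_eq_norm_sq, ← Complex.mul_conj,
    map_sub, map_one, Complex.real_smul]
  push_cast
  linear_combination (-coeff u.fn k) * h2

lemma norm_mFourier_single_sub_one_le {d : ℕ} (k : Fin d → ℤ) (j : Fin d) (t : ℝ) :
    ‖mFourier k (Pi.single j (t : AddCircle (1 : ℝ))) - 1‖ ^ 2 ≤ t ^ 2 * waveNumber k ^ 2 := by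
  have h1 : freq k j * t = Complex.I * ((2 * Real.pi * k j * t : ℝ) : ℂ) := by
    simp only [freq]; push_cast; ring
  rw [mFourier_single_coe, h1]
  refine (pow_le_pow_left₀ (norm_nonneg _) (Real.norm_exp_I_mul_ofReal_sub_one_le) 2).trans ?_
  rw [Real.norm_eq_abs, sq_abs, mul_pow, mul_comm, waveNumber_sq]
  refine mul_le_mul_of_nonneg_left ?_ (sq_nonneg _)
  exact Finset.single_le_sum (f := fun i => (2 * Real.pi * (k i : ℝ)) ^ 2)
    (fun _ _ => sq_nonneg _) (Finset.mem_univ j)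

lemma tendsto_norm_mFourier_sub_one {d : ℕ} (k : Fin d → ℤ) (j : Fin d) :
    Filter.Tendsto
      (fun t : ℝ => ‖mFourier k (Pi.single j (t : AddCircle (1 : ℝ))) - 1‖ ^ 2 / t ^ 2)
      (nhdsWithin 0 {0}ᶜ) (nhds ((2 * Real.pi * (k j : ℝ)) ^ 2)) := by
  have h := (hasDerivAt_mFourier k j 0).tendsto_slope_zero
  have h0 : mFourier k (0 : Torus d) = 1 := by simp [mFourier]
  simp only [zero_add, AddCircle.coe_zero, Pi.single_zero, h0, mul_one] at h
  have h1 := (h.norm).pow 2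
  rw [norm_freq_sq] at h1
  refine h1.congr fun t => ?_
  rw [norm_smul, mul_pow, norm_inv, inv_pow, Real.norm_eq_abs, sq_abs, div_eq_inv_mul]

/-- If the weak Laplacian of `u` tested against second differences is controlled by `g ∈ L²`, then
`u` belongs to `H²`. -/
lemma sum_waveNumber_pow_four_le {d : ℕ} (u : H1 d) (g : L2 d)
    (h : ∀ s : Torus d, ∑ j, inner ℝ (u.grad j) ((secondDiff s u).grad j) ≤
      inner ℝ g (secondDiff s u).fn) (F : Finset (Fin d → ℤ)) :
    ∑ k ∈ F, waveNumber k ^ 4 * ‖coeff u.fn k‖ ^ 2 ≤ d * ‖g‖ ^ 2 := by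
  have key : ∀ j : Fin d, ∀ t : ℝ, t ≠ 0 → ∑ k ∈ F, waveNumber k ^ 2 *
      (‖mFourier k (Pi.single j (t : AddCircle (1 : ℝ))) - 1‖ ^ 2 / t ^ 2) *
        ‖coeff u.fn k‖ ^ 2 ≤ ‖g‖ ^ 2 := by
    intro j t ht
    set s : Torus d := Pi.single j (t : AddCircle (1 : ℝ))
    set v := secondDiff s u
    set A := ∑ j, inner ℝ (u.grad j) (v.grad j)
    have hA : HasSum (fun k => waveNumber k ^ 2 * ‖mFourier k s - 1‖ ^ 2 * ‖coeff u.fn k‖ ^ 2)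
        A := by
      convert! hasSum_inner_grad u v using 1
      funext k
      rw [coeff_secondDiff, mul_left_comm, Complex.re_ofReal_mul, re_conj_mul_self, mul_assoc]
    -- The multiplier enters `‖v‖²` squared; one factor is estimated by `t² |G|²`, the other is
    -- kept.
    have hv : ‖v.fn‖ ^ 2 ≤ t ^ 2 * A := by
      refine hasSum_le (fun k => ?_) (hasSum_norm_sq v.fn) (hA.mul_left (t ^ 2))
      rw [coeff_secondDiff, norm_mul, mul_pow, Complex.norm_real, Real.norm_of_nonneg (sq_nonneg _)]
      have := norm_mFourier_single_sub_one_le k j t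
      calc _ = ‖mFourier k s - 1‖ ^ 2 * ‖mFourier k s - 1‖ ^ 2 * ‖coeff u.fn k‖ ^ 2 := by ring
        _ ≤ (t ^ 2 * waveNumber k ^ 2) * ‖mFourier k s - 1‖ ^ 2 * ‖coeff u.fn k‖ ^ 2 := by gcongr
        _ = _ := by ring
    have hA0 : 0 ≤ A := hA.nonneg fun k => by positivity
    have h1 : A ≤ ‖g‖ * ‖v.fn‖ := (h s).trans (real_inner_le_norm _ _)
    have h2 : A ^ 2 ≤ t ^ 2 * ‖g‖ ^ 2 * A := by
      calc A ^ 2 ≤ (‖g‖ * ‖v.fn‖) ^ 2 := pow_le_pow_left₀ hA0 h1 2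
        _ = ‖g‖ ^ 2 * ‖v.fn‖ ^ 2 := by ring
        _ ≤ ‖g‖ ^ 2 * (t ^ 2 * A) := by gcongr
        _ = _ := by ring
    -- The bound on `A` is quadratic in `t`, so it survives division by `t²` as `t → 0`.
    have h3 : A ≤ t ^ 2 * ‖g‖ ^ 2 := by
      rcases hA0.eq_or_lt with h0 | h0
      · rw [← h0]; positivity
      · exact le_of_mul_le_mul_right (by linarith [sq A]) h0
    have ht2 : 0 < t ^ 2 := by positivity
    calc _ = (∑ k ∈ F, waveNumber k ^ 2 * ‖mFourier k s - 1‖ ^ 2 * ‖coeff u.fn k‖ ^ 2) / t ^ 2 := by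
          rw [Finset.sum_div]
          exact Finset.sum_congr rfl fun k _ => by ring
      _ ≤ A / t ^ 2 := by
          gcongr
          exact sum_le_hasSum F (fun k _ => by positivity) hA
      _ ≤ ‖g‖ ^ 2 := by
          rw [div_le_iff₀ ht2]; linarith
  -- Restricting to the finite set `F` makes the limit `t → 0` termwise; summing over the directions
  -- `j` then yields `|G|⁴`.
  have lim : ∀ j : Fin d, ∑ k ∈ F, waveNumber k ^ 2 * (2 * Real.pi * (k j : ℝ)) ^ 2 *
      ‖coeff u.fn k‖ ^ 2 ≤ ‖g‖ ^ 2 := by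
    intro j
    refine le_of_tendsto (tendsto_finsetSum F fun k _ =>
      ((tendsto_norm_mFourier_sub_one k j).const_mul _).mul_const _) ?_
    filter_upwards [self_mem_nhdsWithin] with t ht
    exact key j t ht
  calc _ = ∑ j, ∑ k ∈ F, waveNumber k ^ 2 * (2 * Real.pi * (k j : ℝ)) ^ 2 *
        ‖coeff u.fn k‖ ^ 2 := by
        rw [Finset.sum_comm]
        refine Finset.sum_congr rfl fun k _ => ?_
        rw [← Finset.sum_mul, ← Finset.mul_sum, ← waveNumber_sq]
        ring
    _ ≤ ∑ _j : Fin d, ‖g‖ ^ 2 := Finset.sum_le_sum fun j _ => lim j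
    _ = _ := by simp

lemma rsob_two_le {d : ℕ} (u : H1 d) (g : L2 d)
    (h : ∀ s : Torus d, ∑ j, inner ℝ (u.grad j) ((secondDiff s u).grad j) ≤
      inner ℝ g (secondDiff s u).fn) :
    rsob 2 u.fn ≤ ENNReal.ofReal (2 * (‖u.fn‖ ^ 2 + d * ‖g‖ ^ 2)) := by
  refine rsob_le_ofReal fun F => ?_
  have h1 := sum_waveNumber_pow_four_le u g h F
  have h2 := sum_le_hasSum F (fun k _ => by positivity) (hasSum_norm_sq u.fn)
  calc _ ≤ ∑ k ∈ F, (2 * ‖coeff u.fn k‖ ^ 2 + 2 * (waveNumber k ^ 4 * ‖coeff u.fn k‖ ^ 2)) := by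
        refine Finset.sum_le_sum fun k _ => ?_
        -- This is `(1 + x)² ≤ 2 + 2x²` with `x = |G|²`.
        nlinarith [mul_nonneg (sq_nonneg (waveNumber k ^ 2 - 1)) (sq_nonneg ‖coeff u.fn k‖)]
    _ ≤ _ := by
        rw [Finset.sum_add_distrib, ← Finset.mul_sum, ← Finset.mul_sum]
        linarith

/-! ### Real-valued versions of the embeddings and product estimates -/

lemma eLpNorm_ofReal {d : ℕ} (u : Torus d → ℝ) (p : ℝ≥0∞) :
    eLpNorm (fun x => (u x : ℂ)) p (torusMeasure d) = eLpNorm u p (torusMeasure d) :=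
  eLpNorm_congr_norm_ae (Filter.Eventually.of_forall fun _ => Complex.norm_real _)

lemma ae_abs_le_of_rsob {d : ℕ} {u : Torus d → ℝ} (hu : MemLp u 2 (torusMeasure d)) {M : ℝ}
    (hM : 0 ≤ M) (h : latticeSum d * rsob 2 u ≤ ENNReal.ofReal (M ^ 2)) :
    ∀ᵐ x ∂(torusMeasure d), |u x| ≤ M := by
  have h1 := (eLpNorm_top_sq_le hu.ofReal).trans h
  rw [ENNReal.ofReal_pow hM] at h1
  have h2 : eLpNorm u ⊤ (torusMeasure d) ≤ ENNReal.ofReal M := by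
    rw [← eLpNorm_ofReal]
    exact (ENNReal.pow_le_pow_left_iff two_ne_zero).1 h1
  rw [eLpNorm_exponent_top] at h2
  filter_upwards [ae_le_eLpNormEssSup (f := u) (μ := torusMeasure d)] with x hx
  have h3 := hx.trans h2
  rwa [← ofReal_norm, ENNReal.ofReal_le_ofReal_iff hM, Real.norm_eq_abs] at h3

lemma H1.memLp_four {d : ℕ} (hd3 : d ≤ 3) (u : H1 d) : MemLp u.fn 4 (torusMeasure d) := by
  refine ⟨(Lp.memLp u.fn).1, ?_⟩
  have h := eLpNorm_four_le (g := fun x => (u.fn x : ℂ)) (Lp.memLp u.fn).ofReal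
  rw [eLpNorm_ofReal] at h
  refine h.trans_lt (ENNReal.rpow_lt_top_of_nonneg (by norm_num) ?_)
  have h1 : rsob 1 u.fn ≠ ⊤ := by rw [H1.rsob_one]; exact ENNReal.ofReal_ne_top
  exact ENNReal.mul_ne_top (ENNReal.mul_ne_top
    (ENNReal.mul_ne_top (by norm_num) (latticeSum_ne_top hd3)) h1) h1

lemma rsob_add_le {d : ℕ} (n : ℕ) {u v : Torus d → ℝ} (hu : MemLp u 2 (torusMeasure d))
    (hv : MemLp v 2 (torusMeasure d)) :
    rsob n (fun x => u x + v x) ≤ 2 * (rsob n u + rsob n v) := by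
  refine le_trans (le_of_eq ?_) (sobSq_add_le n (hu.ofReal.integrable one_le_two)
    (hv.ofReal.integrable one_le_two))
  simp only [rsob, Complex.ofReal_add]
  rfl

lemma rsob_two_mul_le {d : ℕ} {u v : Torus d → ℝ} (hu : MemLp u 2 (torusMeasure d))
    (hv : MemLp v 2 (torusMeasure d)) :
    rsob 2 (fun x => u x * v x) ≤ 16 * latticeSum d * rsob 2 u * rsob 2 v := by
  refine le_trans (le_of_eq ?_) (sobSq_two_mul_le hu.ofReal hv.ofReal)
  simp only [rsob, Complex.ofReal_mul]
  rfl

/-! ### Multiplication operators -/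

/-- Multiplication of square-integrable functions by a bounded function. -/
def mulOp {d : ℕ} (a : Torus d → ℝ) (ha : MemLp a ⊤ (torusMeasure d)) : L2 d →ₗ[ℝ] L2 d where
  toFun u := ((Lp.memLp u).mul ha).toLp (a * ⇑u)
  map_add' u v := by
    refine Lp.ext ?_
    filter_upwards [((Lp.memLp (u + v)).mul ha (r := 2)).coeFn_toLp,
      ((Lp.memLp u).mul ha (r := 2)).coeFn_toLp, ((Lp.memLp v).mul ha (r := 2)).coeFn_toLp,
      Lp.coeFn_add u v, Lp.coeFn_add (((Lp.memLp u).mul ha (r := 2)).toLp (a * ⇑u))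
        (((Lp.memLp v).mul ha (r := 2)).toLp (a * ⇑v))] with x h1 h2 h3 h4 h5
    rw [h1, h5, Pi.add_apply, h2, h3]
    simp only [Pi.mul_apply, h4, Pi.add_apply]
    ring
  map_smul' c u := by
    refine Lp.ext ?_
    filter_upwards [((Lp.memLp (c • u)).mul ha (r := 2)).coeFn_toLp,
      ((Lp.memLp u).mul ha (r := 2)).coeFn_toLp,
      Lp.coeFn_smul c u, Lp.coeFn_smul c (((Lp.memLp u).mul ha (r := 2)).toLp (a * ⇑u))]
      with x h1 h2 h3 h4
    rw [h1, RingHom.id_apply, h4, Pi.smul_apply, h2]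
    simp only [Pi.mul_apply, h3, Pi.smul_apply, smul_eq_mul]
    ring

lemma coeFn_mulOp {d : ℕ} {a : Torus d → ℝ} (ha : MemLp a ⊤ (torusMeasure d)) (u : L2 d) :
    mulOp a ha u =ᵐ[torusMeasure d] fun x => a x * u x :=
  ((Lp.memLp u).mul ha (r := 2)).coeFn_toLp

lemma norm_mulOp_le {d : ℕ} {a : Torus d → ℝ} (ha : MemLp a ⊤ (torusMeasure d)) {A : ℝ}
    (hA : ∀ᵐ x ∂(torusMeasure d), |a x| ≤ A) (u : L2 d) : ‖mulOp a ha u‖ ≤ A * ‖u‖ := by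
  refine Lp.norm_le_mul_norm_of_ae_le_mul ?_
  filter_upwards [coeFn_mulOp ha u, hA] with x h1 h2
  rw [h1, norm_mul, Real.norm_eq_abs]
  gcongr

lemma inner_mulOp {d : ℕ} {a : Torus d → ℝ} (ha : MemLp a ⊤ (torusMeasure d)) (u v : L2 d) :
    inner ℝ (mulOp a ha u) v = ∫ x, a x * u x * v x ∂(torusMeasure d) := by
  rw [L2.inner_eq_integral]
  refine integral_congr_ae ?_
  filter_upwards [coeFn_mulOp ha u] with x hx
  rw [hx]

lemma inner_mulOp_comm {d : ℕ} {a : Torus d → ℝ} (ha : MemLp a ⊤ (torusMeasure d)) (u v : L2 d) :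
    inner ℝ (mulOp a ha u) v = inner ℝ u (mulOp a ha v) := by
  rw [inner_mulOp, ← real_inner_comm, inner_mulOp]
  simp only [mul_right_comm]

lemma L2.integrable_mul {d : ℕ} (u v : L2 d) :
    Integrable (fun x => u x * v x) (torusMeasure d) :=
  MemLp.integrable_mul (p := 2) (q := 2) (Lp.memLp u) (Lp.memLp v)

lemma le_inner_mulOp {d : ℕ} {a : Torus d → ℝ} (ha : MemLp a ⊤ (torusMeasure d)) {c : ℝ}
    (hc : ∀ᵐ x ∂(torusMeasure d), c ≤ a x) (u : L2 d) :
    c * ‖u‖ ^ 2 ≤ inner ℝ (mulOp a ha u) u := by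
  rw [← real_inner_self_eq_norm_sq, L2.inner_eq_integral, L2.inner_eq_integral,
    ← integral_const_mul]
  refine integral_mono_ae ((L2.integrable_mul u u).const_mul c) (L2.integrable_mul _ u) ?_
  filter_upwards [coeFn_mulOp ha u, hc] with x h1 h2
  simp only [h1, mul_assoc]
  exact mul_le_mul_of_nonneg_right h2 (mul_self_nonneg _)

lemma memLp_mul_of_four {d : ℕ} {u v : Torus d → ℝ} (hu : MemLp u 4 (torusMeasure d))
    (hv : MemLp v 4 (torusMeasure d)) : MemLp (fun x => u x * v x) 2 (torusMeasure d) := by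
  have : ENNReal.HolderTriple 4 4 2 := ⟨by
    rw [← two_mul, show (4 : ℝ≥0∞) = 2 * 2 by norm_num, ENNReal.mul_inv (by simp) (by simp),
      ← mul_assoc, ENNReal.mul_inv_cancel (by simp) (by simp), one_mul]⟩
  exact hv.mul hu

lemma integrable_mul_of_four {d : ℕ} {a b c e : Torus d → ℝ} (ha : MemLp a 4 (torusMeasure d))
    (hb : MemLp b 4 (torusMeasure d)) (hc : MemLp c 4 (torusMeasure d))
    (he : MemLp e 4 (torusMeasure d)) :
    Integrable (fun x => (a x * b x) * (c x * e x)) (torusMeasure d) :=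
  MemLp.integrable_mul (p := 2) (q := 2) (memLp_mul_of_four ha hb) (memLp_mul_of_four hc he)

/-! ### The Euler–Lagrange equation -/

/-- The polynomial is minimal at `t = 0`, where its derivative is `a`. The energy along a line is
such a quartic, so its first variation needs no differentiation under the integral. -/
lemma eq_zero_of_quartic_nonneg {a b c e : ℝ}
    (h : ∀ t : ℝ, 0 ≤ t * a + t ^ 2 * b + t ^ 3 * c + t ^ 4 * e) : a = 0 := by
  have hd : HasDerivAt (fun t : ℝ => t * a + t ^ 2 * b + t ^ 3 * c + t ^ 4 * e) a 0 := by
    have h1 := (((hasDerivAt_id (0 : ℝ)).mul_const a).add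
      (((hasDerivAt_pow 2 (0 : ℝ)).mul_const b))).add ((hasDerivAt_pow 3 (0 : ℝ)).mul_const c)
      |>.add ((hasDerivAt_pow 4 (0 : ℝ)).mul_const e)
    convert! h1 using 1
    simp
  refine IsLocalMin.hasDerivAt_eq_zero (Filter.Eventually.of_forall fun t => ?_) hd
  simpa using h t

lemma coeFn_add_smul {d : ℕ} (u v : L2 d) (t : ℝ) :
    (u + t • v : L2 d) =ᵐ[torusMeasure d] fun x => u x + t * v x := by
  filter_upwards [Lp.coeFn_add u (t • v), Lp.coeFn_smul t v] with x h1 h2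
  rw [h1, Pi.add_apply, h2, Pi.smul_apply, smul_eq_mul]

lemma integral_sum_grad_sq {d : ℕ} (u : H1 d) :
    ∫ x, ∑ j, (u.grad j x) ^ 2 ∂(torusMeasure d) = ∑ j, inner ℝ (u.grad j) (u.grad j) := by
  simp only [sq]
  rw [integral_finsetSum _ fun j _ => L2.integrable_mul _ _]
  simp only [L2.inner_eq_integral]

lemma energy_eq {d : ℕ} (V f : L2 d) (hV : MemLp V ⊤ (torusMeasure d)) (u : H1 d) :
    energy V f u = 1 / 2 * ∑ j, inner ℝ (u.grad j) (u.grad j)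
      + 1 / 2 * inner ℝ (mulOp V hV u.fn) u.fn
      + 1 / 4 * ∫ x, (u.fn x) ^ 4 ∂(torusMeasure d) - inner ℝ f u.fn := by
  rw [energy, integral_sum_grad_sq, inner_mulOp, L2.inner_eq_integral]
  simp only [sq, mul_assoc]

lemma integral_add_smul_pow_four {d : ℕ} {u v : L2 d} (hu : MemLp u 4 (torusMeasure d))
    (hv : MemLp v 4 (torusMeasure d)) (t : ℝ) :
    ∫ x, ((u + t • v : L2 d) x) ^ 4 ∂(torusMeasure d) =
      ∫ x, (u x) ^ 4 ∂(torusMeasure d) + t * (4 * ∫ x, (u x) ^ 3 * v x ∂(torusMeasure d))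
      + t ^ 2 * (6 * ∫ x, (u x * u x) * (v x * v x) ∂(torusMeasure d))
      + t ^ 3 * (4 * ∫ x, (u x * v x) * (v x * v x) ∂(torusMeasure d))
      + t ^ 4 * ∫ x, (v x) ^ 4 ∂(torusMeasure d) := by
  -- Quartic products are regrouped as products of two pairs, each pair being in `L²` by Hölder from
  -- `L⁴`.
  have e : ∀ (a b : Torus d → ℝ), (fun x => a x ^ 3 * b x) = fun x => (a x * a x) * (a x * b x) :=
    fun a b => by funext x; ring
  have e' : ∀ (a : Torus d → ℝ), (fun x => a x ^ 4) = fun x => (a x * a x) * (a x * a x) :=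
    fun a => by funext x; ring
  have i0 := integrable_mul_of_four hu hu hu hu
  have i1 := (integrable_mul_of_four hu hu hu hv).const_mul (t * 4)
  have i2 := (integrable_mul_of_four hu hu hv hv).const_mul (t ^ 2 * 6)
  have i3 := (integrable_mul_of_four hu hv hv hv).const_mul (t ^ 3 * 4)
  have i4 := (integrable_mul_of_four hv hv hv hv).const_mul (t ^ 4)
  simp only [e u v, e' u, e' v, ← mul_assoc t 4, ← mul_assoc (t ^ 2) 6, ← mul_assoc (t ^ 3) 4]
  rw [← integral_const_mul, ← integral_const_mul, ← integral_const_mul, ← integral_const_mul,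
    ← integral_add i0 i1, ← integral_add (i0.fun_add i1) i2, ← integral_add ((i0.fun_add i1).fun_add i2) i3,
    ← integral_add (((i0.fun_add i1).fun_add i2).fun_add i3) i4]
  refine integral_congr_ae ?_
  filter_upwards [coeFn_add_smul u v t] with x hx
  simp only [hx]
  ring

/-- The Euler–Lagrange equation of a minimiser of the energy over a subspace. -/
lemma euler_lagrange {d : ℕ} (hd3 : d ≤ 3) {V f : L2 d} (hV : MemLp V ⊤ (torusMeasure d))
    {Y : Submodule ℝ (H1 d)} {u : H1 d} (hu : u ∈ Y)
    (hmin : ∀ v ∈ Y, energy V f u ≤ energy V f v) {v : H1 d} (hv : v ∈ Y) :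
    ∑ j, inner ℝ (u.grad j) (v.grad j) + inner ℝ (mulOp V hV u.fn) v.fn
      + ∫ x, (u.fn x) ^ 3 * v.fn x ∂(torusMeasure d) = inner ℝ f v.fn := by
  have h : ∀ t : ℝ, 0 ≤
      t * (∑ j, inner ℝ (u.grad j) (v.grad j) + inner ℝ (mulOp V hV u.fn) v.fn
        + ∫ x, (u.fn x) ^ 3 * v.fn x ∂(torusMeasure d) - inner ℝ f v.fn)
      + t ^ 2 * (1 / 2 * ∑ j, inner ℝ (v.grad j) (v.grad j)
        + 1 / 2 * inner ℝ (mulOp V hV v.fn) v.fn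
        + 3 / 2 * ∫ x, (u.fn x * u.fn x) * (v.fn x * v.fn x) ∂(torusMeasure d))
      + t ^ 3 * (∫ x, (u.fn x * v.fn x) * (v.fn x * v.fn x) ∂(torusMeasure d))
      + t ^ 4 * (1 / 4 * ∫ x, (v.fn x) ^ 4 ∂(torusMeasure d)) := by
    intro t
    have h1 := hmin (u + t • v) (Y.add_mem hu (Y.smul_mem t hv))
    rw [energy_eq V f hV, energy_eq V f hV] at h1
    simp only [H1.fn_add, H1.fn_smul, H1.grad_add, H1.grad_smul] at h1
    rw [integral_add_smul_pow_four (u.memLp_four hd3) (v.memLp_four hd3)] at h1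
    simp only [map_add, map_smul, inner_add_left, inner_add_right, inner_smul_left,
      inner_smul_right, Finset.sum_add_distrib, ← Finset.mul_sum] at h1
    have h2 : ∑ j, inner ℝ (v.grad j) (u.grad j) = ∑ j, inner ℝ (u.grad j) (v.grad j) :=
      Finset.sum_congr rfl fun j _ => real_inner_comm _ _
    have h3 : inner ℝ (mulOp V hV v.fn) u.fn = inner ℝ (mulOp V hV u.fn) v.fn := by
      rw [inner_mulOp_comm, real_inner_comm]
    rw [h2, h3] at h1
    simp only [conj_trivial] at h1
    linarith
  linarith [eq_zero_of_quartic_nonneg h]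

/-! ### A priori bounds for minimisers -/

lemma MemLp.shift {d : ℕ} {u : L2 d} {p : ℝ≥0∞} (hu : MemLp u p (torusMeasure d)) (s : Torus d) :
    MemLp (shift s u) p (torusMeasure d) :=
  (hu.comp_measurePreserving (measurePreserving_add_right _ s)).ae_eq (coeFn_shift s u).symm

/-- Monotonicity of the cubic nonlinearity, tested against second differences. -/
lemma integral_cube_mul_secondDiff_nonneg {d : ℕ} (hd3 : d ≤ 3) (u : H1 d) (s : Torus d) :
    0 ≤ ∫ x, (u.fn x) ^ 3 * (secondDiff s u).fn x ∂(torusMeasure d) := by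
  have h4 := u.memLp_four hd3
  have i3 : ∀ {a b : L2 d}, MemLp a 4 (torusMeasure d) → MemLp b 4 (torusMeasure d) →
      Integrable (fun x => a x ^ 3 * b x) (torusMeasure d) := fun {a b} ha hb => by
    refine (integrable_mul_of_four ha ha ha hb).congr
      (Filter.Eventually.of_forall fun x => ?_)
    simp only
    ring
  have isub : ∀ {a b : Torus d → ℝ}, Integrable a (torusMeasure d) →
      Integrable b (torusMeasure d) → Integrable (fun x => a x - b x) (torusMeasure d) :=
    fun ha hb => ha.sub hb
  set p := shift s u.fn
  set q := shift (-s) u.fn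
  have hp : MemLp p 4 (torusMeasure d) := MemLp.shift h4 s
  have hq : MemLp q 4 (torusMeasure d) := MemLp.shift h4 (-s)
  -- Translation by `s` turns `∫ u³ u(·-s)` into `∫ u(·+s)³ u`, so only `u` and `p = u(·+s)` remain.
  have e1 : ∫ x, u.fn x ^ 3 * q x ∂(torusMeasure d) = ∫ x, p x ^ 3 * u.fn x ∂(torusMeasure d) := by
    have h1 := integral_add_right_torus (-s) fun x => p x ^ 3 * u.fn x
    rw [← h1]
    have h2 := (measurePreserving_add_right (torusMeasure d) (-s)).quasiMeasurePreserving.ae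
      (coeFn_shift s u.fn)
    refine integral_congr_ae ?_
    filter_upwards [coeFn_shift (-s) u.fn, h2] with x h3 h4
    simp only [p, q]
    rw [h3, h4, neg_add_cancel_right]
  have e2 : ∫ x, u.fn x ^ 3 * u.fn x ∂(torusMeasure d) = ∫ x, p x ^ 3 * p x ∂(torusMeasure d) := by
    rw [← integral_add_right_torus s fun x => u.fn x ^ 3 * u.fn x]
    refine integral_congr_ae ?_
    filter_upwards [coeFn_shift s u.fn] with x h3
    simp only [p]
    rw [h3]
  have e3 : ∫ x, (u.fn x) ^ 3 * (secondDiff s u).fn x ∂(torusMeasure d) =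
      2 * ∫ x, u.fn x ^ 3 * u.fn x ∂(torusMeasure d) - ∫ x, u.fn x ^ 3 * p x ∂(torusMeasure d)
        - ∫ x, u.fn x ^ 3 * q x ∂(torusMeasure d) := by
    rw [← integral_const_mul, ← integral_sub ((i3 h4 h4).const_mul 2) (i3 h4 hp),
      ← integral_sub (isub ((i3 h4 h4).const_mul 2) (i3 h4 hp)) (i3 h4 hq)]
    refine integral_congr_ae ?_
    filter_upwards [Lp.coeFn_sub ((2 : ℝ) • u.fn - p) q, Lp.coeFn_sub ((2 : ℝ) • u.fn) p,
      Lp.coeFn_smul (2 : ℝ) u.fn] with x h1 h2 h3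
    have h5 : (secondDiff s u).fn = (2 : ℝ) • u.fn - p - q := rfl
    rw [h5, h1, Pi.sub_apply, h2, Pi.sub_apply, h3, Pi.smul_apply, smul_eq_mul]
    ring
  -- One of the two copies of `∫ u⁴` is replaced by `∫ p⁴`; the integrand becomes `(u³ - p³)(u -
  -- p)`.
  have e4 : ∫ x, (u.fn x) ^ 3 * (secondDiff s u).fn x ∂(torusMeasure d) =
      ∫ x, (u.fn x ^ 3 * u.fn x + p x ^ 3 * p x - u.fn x ^ 3 * p x - p x ^ 3 * u.fn x)
        ∂(torusMeasure d) := by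
    rw [integral_sub (isub ((i3 h4 h4).fun_add (i3 hp hp)) (i3 h4 hp)) (i3 hp h4),
      integral_sub ((i3 h4 h4).fun_add (i3 hp hp)) (i3 h4 hp),
      integral_add (i3 h4 h4) (i3 hp hp), e3, e1, ← e2]
    ring
  rw [e4]
  refine integral_nonneg fun x => ?_
  have : u.fn x ^ 3 * u.fn x + p x ^ 3 * p x - u.fn x ^ 3 * p x - p x ^ 3 * u.fn x =
      (u.fn x - p x) ^ 2 * ((u.fn x + p x) ^ 2 + u.fn x ^ 2 + p x ^ 2) / 2 := by ring
  simp only [Pi.zero_apply, this]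
  positivity

/-- A minimiser over a translation-invariant subspace is bounded in `H²` by the data. -/
lemma rsob_two_minimiser_le {d : ℕ} (hd3 : d ≤ 3) {V f : L2 d}
    (hV : MemLp V ⊤ (torusMeasure d)) {B c : ℝ} (hc : 0 < c)
    (hB : ∀ᵐ x ∂(torusMeasure d), |V x| ≤ B) (hVc : ∀ᵐ x ∂(torusMeasure d), c ≤ V x)
    {Y : Submodule ℝ (H1 d)} (hY : ∀ u ∈ Y, ∀ s, H1.shift s u ∈ Y) {u : H1 d} (hu : u ∈ Y)
    (hmin : ∀ v ∈ Y, energy V f u ≤ energy V f v) :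
    rsob 2 u.fn ≤
      ENNReal.ofReal (2 * ((‖f‖ / c) ^ 2 + d * (‖f‖ + B * (‖f‖ / c)) ^ 2)) := by
  have hB0 : 0 ≤ B := by
    obtain ⟨x, hx⟩ := hB.exists
    exact (abs_nonneg _).trans hx
  -- Testing with `u` itself, the gradient and quartic terms are nonnegative and dropped.
  have hnorm : ‖u.fn‖ ≤ ‖f‖ / c := by
    have h1 := euler_lagrange hd3 hV hu hmin hu
    have h2 := le_inner_mulOp hV hVc u.fn
    have h3 : 0 ≤ ∑ j, inner ℝ (u.grad j) (u.grad j) :=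
      Finset.sum_nonneg fun j _ => real_inner_self_nonneg
    have h4 : 0 ≤ ∫ x, (u.fn x) ^ 3 * u.fn x ∂(torusMeasure d) := integral_nonneg fun x => by
      have : u.fn x ^ 3 * u.fn x = (u.fn x ^ 2) ^ 2 := by ring
      simp only [Pi.zero_apply, this]
      positivity
    have h5 := real_inner_le_norm f u.fn
    rw [le_div_iff₀ hc]
    rcases (norm_nonneg u.fn).eq_or_lt with h0 | h0
    · rw [← h0, zero_mul]; exact norm_nonneg _
    · refine le_of_mul_le_mul_right ?_ h0
      nlinarith
  -- The cubic term tested against a second difference is nonnegative and can be discarded, so no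
  -- bound on `u³` is needed.
  have hreg := rsob_two_le u (f - mulOp V hV u.fn) fun s => by
    have hmem : secondDiff s u ∈ Y :=
      Y.sub_mem (Y.sub_mem (Y.smul_mem 2 hu) (hY u hu s)) (hY u hu (-s))
    have h1 := euler_lagrange hd3 hV hu hmin hmem
    have h2 := integral_cube_mul_secondDiff_nonneg hd3 u s
    rw [inner_sub_left]
    linarith
  refine hreg.trans (ENNReal.ofReal_le_ofReal ?_)
  have h1 : ‖f - mulOp V hV u.fn‖ ≤ ‖f‖ + B * (‖f‖ / c) :=
    (norm_sub_le _ _).trans (add_le_add le_rfl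
      ((norm_mulOp_le hV hB _).trans (mul_le_mul_of_nonneg_left hnorm hB0)))
  gcongr

/-! ### Properties of the projection and of the discrete space -/

lemma coeff_projN {d N : ℕ} (u : H1 d) {k : Fin d → ℤ} (hk : waveNumber k ≤ 2 * Real.pi * N) :
    coeff (projN d N u).fn k = coeff u.fn k := by
  have h := coeff_sub_projN u hk
  rw [H1.fn_sub, coeff_sub, sub_eq_zero] at h
  exact h.symm

lemma rsob_projN_le {d N : ℕ} (n : ℕ) (u : H1 d) :
    rsob n (projN d N u).fn ≤ rsob n u.fn := by
  rw [rsob_eq, rsob_eq]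
  refine ENNReal.tsum_le_tsum fun k => ?_
  by_cases hk : waveNumber k ≤ 2 * Real.pi * N
  · rw [coeff_projN u hk]
  · rw [coeff_eq_zero (projN_mem u) hk]
    simp

/-- The projection error and elements of `X_N` have disjoint Fourier supports, so they are
orthogonal for the gradient part alone. -/
lemma sum_inner_grad_sub_projN {d N : ℕ} (u : H1 d) {v : H1 d} (hv : v ∈ fourierSpace d N) :
    ∑ j, inner ℝ ((u - projN d N u).grad j) (v.grad j) = 0 := by
  refine (hasSum_inner_grad (u - projN d N u) v).unique ?_
  convert! hasSum_zero using 1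
  funext k
  by_cases hk : waveNumber k ≤ 2 * Real.pi * N
  · rw [coeff_sub_projN u hk]
    simp
  · rw [coeff_eq_zero hv hk]
    simp

/-- The inverse inequality on `X_N`. -/
lemma norm_le_of_mem_fourierSpace {d N : ℕ} (hN : 1 ≤ N) {u : H1 d} (hu : u ∈ fourierSpace d N) :
    ‖u‖ ≤ 7 * N * ‖u.fn‖ := by
  have hN' : (1 : ℝ) ≤ N := by exact_mod_cast hN
  refine le_of_sq_le_sq ?_ (by positivity)
  rw [mul_pow]
  refine hasSum_le (fun k => ?_) u.hasSum_norm_sq ((hasSum_norm_sq u.fn).mul_left _)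
  by_cases hk : waveNumber k ≤ 2 * Real.pi * N
  · refine mul_le_mul_of_nonneg_right ?_ (sq_nonneg _)
    have h1 : waveNumber k ^ 2 ≤ (2 * Real.pi * N) ^ 2 :=
      pow_le_pow_left₀ (waveNumber_nonneg k) hk 2
    -- The constant 7 comes from `1 + 4π²N² ≤ 41 N² ≤ 49 N²`.
    have h2 : Real.pi ^ 2 ≤ 10 := by nlinarith [Real.pi_lt_d2, Real.pi_pos]
    have h3 : (1 : ℝ) ≤ (N : ℝ) ^ 2 := one_le_pow₀ hN'
    nlinarith [mul_le_mul_of_nonneg_right h2 (sq_nonneg (N : ℝ))]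
  · rw [coeff_eq_zero hu hk]
    simp

/-- Functions without low frequencies are small in the dual of `H²`. -/
lemma ofReal_inner_sq_le {d N : ℕ} (hN : 1 ≤ N) (w : H1 d)
    (hw : ∀ k, waveNumber k ≤ 2 * Real.pi * N → coeff w.fn k = 0) (z : L2 d) :
    ENNReal.ofReal ((inner ℝ w.fn z) ^ 2) ≤
      ENNReal.ofReal (((N : ℝ) ^ 6)⁻¹ * ‖w‖ ^ 2) * rsob 2 z := by
  have hN' : (1 : ℝ) ≤ N := by exact_mod_cast hN
  have h1 : ‖inner ℝ w.fn z‖ₑ ≤ ∑' k, ((symb k)⁻¹ * ‖coeff w.fn k‖ₑ) * (symb k * ‖coeff z k‖ₑ) := by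
    rw [← (hasSum_inner w.fn z).tsum_eq]
    refine enorm_tsum_le_tsum_enorm.trans (ENNReal.tsum_le_tsum fun k => ?_)
    rw [mul_mul_mul_comm, ENNReal.inv_mul_cancel (symb_ne_zero k) (symb_ne_top k), one_mul,
      ← enorm_mul, ← ofReal_norm, ← ofReal_norm]
    refine ENNReal.ofReal_le_ofReal ((Complex.abs_re_le_norm _).trans (le_of_eq ?_))
    rw [norm_mul, norm_mul, RCLike.norm_conj]
  have h2 := (pow_le_pow_left' h1 2).trans (ennreal_tsum_mul_sq_le _ _)
  -- On the frequencies carried by `w`, `symb ≥ N²`, so `symb⁻² ≤ N⁻⁶ symb`: this is the source of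
  -- the rate `N⁻³`.
  have h3 : ∑' k, ((symb k)⁻¹ * ‖coeff w.fn k‖ₑ) ^ 2 ≤
      ENNReal.ofReal (((N : ℝ) ^ 6)⁻¹) * rsob 1 w.fn := by
    rw [rsob_eq, ← ENNReal.tsum_mul_left]
    refine ENNReal.tsum_le_tsum fun k => ?_
    by_cases hk : waveNumber k ≤ 2 * Real.pi * N
    · rw [hw k hk]
      simp
    · rw [mul_pow, ← mul_assoc, pow_one]
      refine mul_le_mul_left ?_ _
      have hpos : (0 : ℝ) < 1 + waveNumber k ^ 2 := by positivity
      rw [symb, ← ENNReal.ofReal_inv_of_pos hpos, ← ENNReal.ofReal_pow (by positivity),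
        ← ENNReal.ofReal_mul (by positivity)]
      refine ENNReal.ofReal_le_ofReal ?_
      have h4 : (N : ℝ) ≤ waveNumber k := by
        have : (N : ℝ) ≤ 2 * Real.pi * N := by nlinarith [Real.pi_gt_three]
        linarith [not_le.1 hk]
      have h5 : (N : ℝ) ^ 2 ≤ 1 + waveNumber k ^ 2 := by
        have := pow_le_pow_left₀ (by positivity) h4 2
        linarith
      have h6 := pow_le_pow_left₀ (by positivity) h5 3
      rw [← pow_mul] at h6
      norm_num at h6
      rw [inv_pow, inv_mul_eq_div, le_div_iff₀ (by positivity), inv_mul_le_iff₀ (by positivity)]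
      linarith [pow_succ (1 + waveNumber k ^ 2) 2]
  have h5 : ENNReal.ofReal ((inner ℝ w.fn z) ^ 2) = ‖inner ℝ w.fn z‖ₑ ^ 2 := by
    rw [← ofReal_norm, ← ENNReal.ofReal_pow (norm_nonneg _), Real.norm_eq_abs, sq_abs]
  rw [h5, ENNReal.ofReal_mul (by positivity), ← H1.rsob_one]
  refine h2.trans (mul_le_mul' h3 (le_of_eq ?_))
  rw [rsob_eq]
  exact tsum_congr fun k => mul_pow _ _ _

/-! ### The discrete dual problem -/

/-- The bilinear form `∫ ∇u · ∇v + ∫ a u v`. -/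
def formB {d : ℕ} (a : Torus d → ℝ) (ha : MemLp a ⊤ (torusMeasure d)) (u v : H1 d) : ℝ :=
  ∑ j, inner ℝ (u.grad j) (v.grad j) + inner ℝ (mulOp a ha u.fn) v.fn

lemma formB_comm {d : ℕ} {a : Torus d → ℝ} (ha : MemLp a ⊤ (torusMeasure d)) (u v : H1 d) :
    formB a ha u v = formB a ha v u := by
  unfold formB
  rw [inner_mulOp_comm, real_inner_comm u.fn]
  congr 1
  exact Finset.sum_congr rfl fun j _ => real_inner_comm _ _

lemma le_formB_self {d : ℕ} {a : Torus d → ℝ} (ha : MemLp a ⊤ (torusMeasure d)) {c : ℝ}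
    (hc : ∀ᵐ x ∂(torusMeasure d), c ≤ a x) (u : H1 d) : c * ‖u.fn‖ ^ 2 ≤ formB a ha u u := by
  have h1 := le_inner_mulOp ha hc u.fn
  have h2 : 0 ≤ ∑ j, inner ℝ (u.grad j) (u.grad j) :=
    Finset.sum_nonneg fun j _ => real_inner_self_nonneg
  unfold formB
  linarith

/-- The form is positive definite on `Y`, so it maps `Y` injectively into its dual; equality of
finite dimensions gives surjectivity. -/
lemma exists_formB_eq {d : ℕ} {a : Torus d → ℝ} (ha : MemLp a ⊤ (torusMeasure d)) {c : ℝ}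
    (hc0 : 0 < c) (hc : ∀ᵐ x ∂(torusMeasure d), c ≤ a x) (Y : Submodule ℝ (H1 d))
    [FiniteDimensional ℝ Y] (g : L2 d) :
    ∃ ψ ∈ Y, ∀ v ∈ Y, formB a ha ψ v = inner ℝ g v.fn := by
  let T : Y →ₗ[ℝ] Module.Dual ℝ Y := LinearMap.mk₂ ℝ (fun u v : Y => formB a ha u v)
    (fun u u' v => by
      simp only [formB, Submodule.coe_add, H1.grad_add, H1.fn_add, map_add, inner_add_left,
        Finset.sum_add_distrib]
      ring)
    (fun r u v => by
      simp only [formB, Submodule.coe_smul, H1.grad_smul, H1.fn_smul, map_smul, inner_smul_left,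
        ← Finset.mul_sum, smul_eq_mul, conj_trivial]
      ring)
    (fun u v v' => by
      simp only [formB, Submodule.coe_add, H1.grad_add, H1.fn_add, inner_add_right,
        Finset.sum_add_distrib]
      ring)
    (fun r u v => by
      simp only [formB, Submodule.coe_smul, H1.grad_smul, H1.fn_smul, inner_smul_right,
        ← Finset.mul_sum, smul_eq_mul]
      ring)
  have hT : Function.Injective T := by
    refine (injective_iff_map_eq_zero T).2 fun u hu => ?_
    have h1 : formB a ha u u = 0 := congrArg (fun L : Module.Dual ℝ Y => L u) hu
    have h2 := le_formB_self ha hc (u : H1 d)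
    have h3 : ‖(u : H1 d).fn‖ ^ 2 = 0 := by
      have : 0 ≤ ‖(u : H1 d).fn‖ ^ 2 := sq_nonneg _
      nlinarith
    have h4 : (u : H1 d).fn = 0 := by simpa using h3
    exact Subtype.ext (H1.fn_injective d h4)
  have hsurj : Function.Surjective T :=
    (LinearMap.injective_iff_surjective_of_finrank_eq_finrank
      (Subspace.dual_finrank_eq (K := ℝ) (V := Y)).symm).1 hT
  let G : Module.Dual ℝ Y :=
    { toFun := fun v => inner ℝ g (v : H1 d).fn
      map_add' := fun v v' => inner_add_right _ _ _
      map_smul' := fun r v => inner_smul_right _ _ _ }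
  obtain ⟨ψ, hψ⟩ := hsurj G
  exact ⟨ψ, ψ.2, fun v hv => congrArg (fun L : Module.Dual ℝ Y => L ⟨v, hv⟩) hψ⟩

/-- `H²`-stability of the linear problem on translation-invariant subspaces. -/
lemma rsob_two_formB_le {d : ℕ} {a : Torus d → ℝ} (ha : MemLp a ⊤ (torusMeasure d)) {A c : ℝ}
    (hc0 : 0 < c) (hc : ∀ᵐ x ∂(torusMeasure d), c ≤ a x)
    (hA : ∀ᵐ x ∂(torusMeasure d), |a x| ≤ A) {Y : Submodule ℝ (H1 d)}
    (hY : ∀ u ∈ Y, ∀ s, H1.shift s u ∈ Y) {ψ : H1 d} (hψ : ψ ∈ Y) {g : L2 d}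
    (h : ∀ v ∈ Y, formB a ha ψ v = inner ℝ g v.fn) :
    rsob 2 ψ.fn ≤ ENNReal.ofReal (2 * ((1 / c) ^ 2 + d * (1 + A * (1 / c)) ^ 2) * ‖g‖ ^ 2) := by
  have hA0 : 0 ≤ A := by
    obtain ⟨x, hx⟩ := hA.exists
    exact (abs_nonneg _).trans hx
  have hnorm : ‖ψ.fn‖ ≤ 1 / c * ‖g‖ := by
    have h1 := le_formB_self ha hc ψ
    rw [h ψ hψ] at h1
    have h2 := real_inner_le_norm g ψ.fn
    rw [div_mul_eq_mul_div, one_mul, le_div_iff₀ hc0]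
    rcases (norm_nonneg ψ.fn).eq_or_lt with h0 | h0
    · rw [← h0, zero_mul]; exact norm_nonneg _
    · exact le_of_mul_le_mul_right (by nlinarith) h0
  have hreg := rsob_two_le ψ (g - mulOp a ha ψ.fn) fun s => by
    have h1 := h _ (Y.sub_mem (Y.sub_mem (Y.smul_mem 2 hψ) (hY ψ hψ s)) (hY ψ hψ (-s)))
    rw [inner_sub_left]
    exact (eq_sub_of_add_eq h1).le
  refine hreg.trans (ENNReal.ofReal_le_ofReal ?_)
  have h1 : ‖g - mulOp a ha ψ.fn‖ ≤ (1 + A * (1 / c)) * ‖g‖ := by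
    refine (norm_sub_le _ _).trans ?_
    have := (norm_mulOp_le ha hA ψ.fn).trans (mul_le_mul_of_nonneg_left hnorm hA0)
    linarith
  calc _ ≤ 2 * ((1 / c * ‖g‖) ^ 2 + d * ((1 + A * (1 / c)) * ‖g‖) ^ 2) := by gcongr
    _ = _ := by ring

/-! ### The error equation -/

lemma memLp_top_of_ae_abs_le {d : ℕ} {u : Torus d → ℝ}
    (hu : AEStronglyMeasurable u (torusMeasure d)) {M : ℝ}
    (h : ∀ᵐ x ∂(torusMeasure d), |u x| ≤ M) : MemLp u ⊤ (torusMeasure d) :=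
  memLp_top_of_bound hu M h

/-- The coefficient `V + u² + u v + v²` of the linearised difference of the equations at `u`
and `v`. -/
def diffCoeff {d : ℕ} (V u v : L2 d) (x : Torus d) : ℝ :=
  V x + (u x * u x + (u x * v x + v x * v x))

lemma memLp_top_mul {d : ℕ} {u v : Torus d → ℝ} (hu : MemLp u ⊤ (torusMeasure d))
    (hv : MemLp v ⊤ (torusMeasure d)) : MemLp (fun x => u x * v x) ⊤ (torusMeasure d) :=
  hv.mul hu

lemma memLp_top_diffCoeff {d : ℕ} {V u v : L2 d} (hV : MemLp V ⊤ (torusMeasure d))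
    (hu : MemLp u ⊤ (torusMeasure d)) (hv : MemLp v ⊤ (torusMeasure d)) :
    MemLp (diffCoeff V u v) ⊤ (torusMeasure d) :=
  hV.add ((memLp_top_mul hu hu).add ((memLp_top_mul hu hv).add (memLp_top_mul hv hv)))

/-- `u² + uv + v²` is half of `(u + v)² + u² + v²`, hence nonnegative: monotonicity of the cube
makes the linearised problem inherit the coercivity constant of `V`. -/
lemma le_diffCoeff {d : ℕ} {V u v : L2 d} {c : ℝ} (hc : ∀ᵐ x ∂(torusMeasure d), c ≤ V x) :
    ∀ᵐ x ∂(torusMeasure d), c ≤ diffCoeff V u v x := by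
  filter_upwards [hc] with x hx
  unfold diffCoeff
  nlinarith [sq_nonneg (u x + v x), sq_nonneg (u x), sq_nonneg (v x)]

lemma abs_diffCoeff_le {d : ℕ} {V u v : L2 d} {B M : ℝ}
    (hB : ∀ᵐ x ∂(torusMeasure d), |V x| ≤ B) (hu : ∀ᵐ x ∂(torusMeasure d), |u x| ≤ M)
    (hv : ∀ᵐ x ∂(torusMeasure d), |v x| ≤ M) :
    ∀ᵐ x ∂(torusMeasure d), |diffCoeff V u v x| ≤ B + 3 * M ^ 2 := by
  filter_upwards [hB, hu, hv] with x h1 h2 h3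
  have hM : 0 ≤ M := (abs_nonneg _).trans h2
  have key : ∀ {a b : ℝ}, |a| ≤ M → |b| ≤ M → |a * b| ≤ M ^ 2 := fun ha hb => by
    rw [abs_mul, sq]
    exact mul_le_mul ha hb (abs_nonneg _) hM
  have k1 := key h2 h2
  have k2 := key h2 h3
  have k3 := key h3 h3
  have t1 := abs_add_le (V x) (u x * u x + (u x * v x + v x * v x))
  have t2 := abs_add_le (u x * u x) (u x * v x + v x * v x)
  have t3 := abs_add_le (u x * v x) (v x * v x)
  unfold diffCoeff
  linarith

/-- The algebra property bounds each of the three products, and the nested bracketing of `diffCoeff`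
fixes the constants. Only `S` and `V` appear, so the bound is uniform in `N`. -/
lemma rsob_two_diffCoeff_le {d : ℕ} {V u v : L2 d} (hu : MemLp u ⊤ (torusMeasure d))
    (hv : MemLp v ⊤ (torusMeasure d)) {S : ℝ≥0∞} (hSu : rsob 2 u ≤ S) (hSv : rsob 2 v ≤ S) :
    rsob 2 (diffCoeff V u v) ≤ 2 * (rsob 2 V + 2 * (16 * latticeSum d * S * S +
      2 * (16 * latticeSum d * S * S + 16 * latticeSum d * S * S))) := by
  have m : ∀ {a b : Torus d → ℝ}, MemLp a ⊤ (torusMeasure d) → MemLp b ⊤ (torusMeasure d) →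
      MemLp (fun x => a x * b x) 2 (torusMeasure d) := fun ha hb =>
    (memLp_top_mul ha hb).mono_exponent le_top
  have key : ∀ {a b : L2 d}, rsob 2 a ≤ S → rsob 2 b ≤ S →
      rsob 2 (fun x => a x * b x) ≤ 16 * latticeSum d * S * S := fun {a b} ha hb =>
    (rsob_two_mul_le (Lp.memLp a) (Lp.memLp b)).trans (by gcongr)
  refine (rsob_add_le 2 (Lp.memLp V) ((m hu hu).add ((m hu hv).add (m hv hv)))).trans ?_
  gcongr
  refine (rsob_add_le 2 (m hu hu) ((m hu hv).add (m hv hv))).trans ?_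
  gcongr
  · exact key hSu hSu
  refine (rsob_add_le 2 (m hu hv) (m hv hv)).trans ?_
  gcongr
  · exact key hSu hSv
  · exact key hSv hSv

lemma integral_cube_mul {d : ℕ} {u : L2 d} (hu : MemLp u ⊤ (torusMeasure d)) (v : L2 d) :
    ∫ x, (u x) ^ 3 * v x ∂(torusMeasure d) =
      inner ℝ (mulOp (fun x => u x * u x) (memLp_top_mul hu hu) u) v := by
  rw [inner_mulOp]
  congr 1
  funext x
  ring

/-- The difference is split at `p`, and each of `p³ - q³` and `u³ - p³` is factored. This separates
the discrete error `p - q` from the projection error `u - p`. -/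
lemma mulOp_cube_sub {d : ℕ} {V u p q : L2 d} (hV : MemLp V ⊤ (torusMeasure d))
    (hu : MemLp u ⊤ (torusMeasure d)) (hp : MemLp p ⊤ (torusMeasure d))
    (hq : MemLp q ⊤ (torusMeasure d)) :
    mulOp V hV u + mulOp (fun x => u x * u x) (memLp_top_mul hu hu) u
        - (mulOp V hV q + mulOp (fun x => q x * q x) (memLp_top_mul hq hq) q) =
      mulOp (diffCoeff V p q) (memLp_top_diffCoeff hV hp hq) (p - q)
        + mulOp (diffCoeff V u p) (memLp_top_diffCoeff hV hu hp) (u - p) := by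
  refine Lp.ext ?_
  refine (Lp.coeFn_sub _ _).trans (Filter.EventuallyEq.trans ?_ (Lp.coeFn_add _ _).symm)
  filter_upwards [Lp.coeFn_add (mulOp V hV u)
      (mulOp (fun x => u x * u x) (memLp_top_mul hu hu) u),
    Lp.coeFn_add (mulOp V hV q) (mulOp (fun x => q x * q x) (memLp_top_mul hq hq) q),
    coeFn_mulOp hV u, coeFn_mulOp hV q, coeFn_mulOp (memLp_top_mul hu hu) u,
    coeFn_mulOp (memLp_top_mul hq hq) q,
    coeFn_mulOp (memLp_top_diffCoeff hV hp hq) (p - q),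
    coeFn_mulOp (memLp_top_diffCoeff hV hu hp) (u - p),
    Lp.coeFn_sub p q, Lp.coeFn_sub u p] with x h1 h2 h3 h4 h5 h6 h7 h8 h9 h10
  rw [Pi.sub_apply, Pi.add_apply, h1, h2, Pi.add_apply, Pi.add_apply, h3, h4, h5, h6, h7, h8, h9,
    h10, Pi.sub_apply, Pi.sub_apply]
  unfold diffCoeff
  ring

/-- The equation for the discrete error `Π_N u - u_N`. -/
lemma formB_error_eq {d N : ℕ} (hd3 : d ≤ 3) {V f : L2 d} (hV : MemLp V ⊤ (torusMeasure d))
    {u q : H1 d} (hu : ∀ v, energy V f u ≤ energy V f v) (hq : q ∈ fourierSpace d N)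
    (hqmin : ∀ v ∈ fourierSpace d N, energy V f q ≤ energy V f v)
    (hu' : MemLp u.fn ⊤ (torusMeasure d)) (hp' : MemLp (projN d N u).fn ⊤ (torusMeasure d))
    (hq' : MemLp q.fn ⊤ (torusMeasure d)) {v : H1 d} (hv : v ∈ fourierSpace d N) :
    formB (diffCoeff V (projN d N u).fn q.fn) (memLp_top_diffCoeff hV hp' hq') (projN d N u - q) v =
      -inner ℝ (u - projN d N u).fn
        (mulOp (diffCoeff V u.fn (projN d N u).fn) (memLp_top_diffCoeff hV hu' hp') v.fn) := by
  have h1 := euler_lagrange hd3 hV (Y := ⊤) (v := v) Submodule.mem_top (fun v _ => hu v)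
    Submodule.mem_top
  have h2 := euler_lagrange hd3 hV hq hqmin hv
  rw [integral_cube_mul hu'] at h1
  rw [integral_cube_mul hq'] at h2
  have h3 := congrArg (fun z => inner ℝ z v.fn) (mulOp_cube_sub hV hu' hp' hq')
  have h4 := sum_inner_grad_sub_projN u hv
  simp only [inner_sub_left, inner_add_left] at h3
  simp only [H1.grad_sub, inner_sub_left, Finset.sum_sub_distrib] at h4
  -- Multiplication is symmetric, so the coefficient may sit on `v`; this leaves `u - p` bare, ready
  -- for the high-frequency estimate.
  rw [← inner_mulOp_comm]
  simp only [formB, H1.grad_sub, H1.fn_sub, inner_sub_left, Finset.sum_sub_distrib]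
  linarith

/-! ### The error estimate -/

/-- The error estimate at level `N`, with a constant depending only on bounds for the data. -/
lemma norm_projN_sub_le {d N : ℕ} (hd3 : d ≤ 3) (hN : 1 ≤ N) {V f : L2 d}
    (hV : MemLp V ⊤ (torusMeasure d)) {B M c : ℝ} (hc0 : 0 < c)
    (hc : ∀ᵐ x ∂(torusMeasure d), c ≤ V x) (hB : ∀ᵐ x ∂(torusMeasure d), |V x| ≤ B)
    {S K : ℝ≥0∞} (hM0 : 0 ≤ M) (hSM : latticeSum d * S ≤ ENNReal.ofReal (M ^ 2))
    (hK : 16 * latticeSum d * (2 * (rsob 2 V + 2 * (16 * latticeSum d * S * S +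
      2 * (16 * latticeSum d * S * S + 16 * latticeSum d * S * S)))) = K) (hKt : K ≠ ⊤)
    {u q : H1 d} (hu : ∀ v, energy V f u ≤ energy V f v) (hq : q ∈ fourierSpace d N)
    (hqmin : ∀ v ∈ fourierSpace d N, energy V f q ≤ energy V f v)
    (hSu : rsob 2 u.fn ≤ S) (hSq : rsob 2 q.fn ≤ S) :
    ‖(projN d N u - q).fn‖ ≤
      √(K.toReal * (2 * ((1 / c) ^ 2 + d * (1 + (B + 3 * M ^ 2) * (1 / c)) ^ 2))) *
        (((N : ℝ) ^ 3)⁻¹ * ‖u - projN d N u‖) := by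
  set p := projN d N u
  have hSp : rsob 2 p.fn ≤ S := (rsob_projN_le 2 u).trans hSu
  have hbd : ∀ {z : H1 d}, rsob 2 z.fn ≤ S → ∀ᵐ x ∂(torusMeasure d), |z.fn x| ≤ M := fun {z} hz =>
    ae_abs_le_of_rsob (Lp.memLp z.fn) hM0 ((mul_le_mul_right hz _).trans hSM)
  have htop : ∀ {z : H1 d}, rsob 2 z.fn ≤ S → MemLp z.fn ⊤ (torusMeasure d) := fun {z} hz =>
    memLp_top_of_ae_abs_le (Lp.memLp z.fn).1 (hbd hz)
  have hY : ∀ z ∈ fourierSpace d N, ∀ s, H1.shift s z ∈ fourierSpace d N :=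
    fun z hz s => shift_mem_fourierSpace hz s
  set e := p - q
  set w := u - p
  have he : e ∈ fourierSpace d N := Submodule.sub_mem _ (projN_mem u) hq
  have ha := memLp_top_diffCoeff hV (htop hSp) (htop hSq)
  have hb := memLp_top_diffCoeff hV (htop hSu) (htop hSp)
  have hac : ∀ᵐ x ∂(torusMeasure d), c ≤ diffCoeff V p.fn q.fn x := le_diffCoeff hc
  -- Dual problem posed in `X_N` itself: since `e` lies in `X_N`, no continuous dual solution or
  -- approximation of it is needed.
  obtain ⟨ψ, hψ, hψe⟩ := exists_formB_eq ha hc0 hac (fourierSpace d N) e.fn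
  have hψ2 := rsob_two_formB_le ha hc0 hac (abs_diffCoeff_le hB (hbd hSp) (hbd hSq)) hY hψ hψe
  set K2 : ℝ := 2 * ((1 / c) ^ 2 + d * (1 + (B + 3 * M ^ 2) * (1 / c)) ^ 2)
  have hK2 : 0 ≤ K2 := by positivity
  set z := mulOp (diffCoeff V u.fn p.fn) hb ψ.fn
  -- Test the dual equation with `e`, swap the arguments by symmetry, and test the error equation
  -- with `ψ`.
  have hee : ‖e.fn‖ ^ 2 = -inner ℝ w.fn z := by
    rw [← real_inner_self_eq_norm_sq, ← hψe e he, formB_comm]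
    exact formB_error_eq hd3 hV hu hq hqmin (htop hSu) (htop hSp) (htop hSq) hψ
  have hz : rsob 2 z ≤ ENNReal.ofReal (K.toReal * (K2 * ‖e.fn‖ ^ 2)) := by
    rw [rsob_congr (coeFn_mulOp hb ψ.fn)]
    refine (rsob_two_mul_le (hb.mono_exponent le_top) (Lp.memLp ψ.fn)).trans ?_
    rw [ENNReal.ofReal_mul ENNReal.toReal_nonneg, ENNReal.ofReal_toReal hKt, ← hK]
    refine mul_le_mul' (mul_le_mul_right ?_ _) hψ2
    exact rsob_two_diffCoeff_le (htop hSu) (htop hSp) hSu hSp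
  have hdual := (ofReal_inner_sq_le hN w (fun k hk => coeff_sub_projN u hk) z).trans
    (mul_le_mul_right hz _)
  rw [← ENNReal.ofReal_mul (by positivity), ENNReal.ofReal_le_ofReal_iff (by positivity)] at hdual
  have hsq : (inner ℝ w.fn z) ^ 2 = ‖e.fn‖ ^ 2 * ‖e.fn‖ ^ 2 := by rw [hee]; ring
  rw [hsq] at hdual
  refine le_of_sq_le_sq ?_ (by positivity)
  rw [mul_pow, Real.sq_sqrt (by positivity), mul_pow, inv_pow, ← pow_mul]
  -- The estimate reads `‖e‖⁴ ≤ C ‖e‖²`, because `‖bψ‖_{H²}` is itself bounded by `‖e‖`; one factor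
  -- `‖e‖²` cancels.
  rcases (sq_nonneg ‖e.fn‖).eq_or_lt with h0 | h0
  · rw [← h0]; positivity
  · refine le_of_mul_le_mul_right (hdual.trans (le_of_eq ?_)) h0
    ring

end FourierGP

end

/-! ### Uniform bounds from the data and the final estimate -/

theorem mainTheorem4 (d : ℕ) (hd1 : 1 ≤ d) (hd3 : d ≤ 3) (rv s : ℝ) (hrv : 2 ≤ rv) (hs : 1 ≤ s)
    (V f : FourierGP.L2 d) (hV : FourierGP.MemSobolev rv V) (hf : FourierGP.MemSobolev s f)
    (Vmin : ℝ) (hVmin : 0 < Vmin) (hVbound : ∀ᵐ x ∂(FourierGP.torusMeasure d), Vmin ≤ V x)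
    (uStar : FourierGP.H1 d)
    (huStar : ∀ v : FourierGP.H1 d, FourierGP.energy V f uStar ≤ FourierGP.energy V f v) :
    ∃ C : ℝ, 0 < C ∧ ∀ N : ℕ, 1 ≤ N → ∀ uN ∈ FourierGP.fourierSpace d N,
      (∀ v ∈ FourierGP.fourierSpace d N, FourierGP.energy V f uN ≤ FourierGP.energy V f v) →
      ‖(FourierGP.projN d N uStar - uN).fn‖ +
          (N : ℝ) ^ (-1 : ℤ) * ‖FourierGP.projN d N uStar - uN‖ ≤
        C * ((N : ℝ) ^ (-3 : ℤ) * ‖FourierGP.projN d N uStar - uStar‖) := by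
  open FourierGP in
  have hΛ := latticeSum_ne_top hd3
  have hV2 : rsob 2 V ≠ ⊤ := rsob_ne_top_of_memSobolev (n := 2) (by exact_mod_cast hrv) hV
  have bound : ∀ {T : ENNReal}, T ≠ ⊤ →
      latticeSum d * T ≤ ENNReal.ofReal (√(latticeSum d * T).toReal ^ 2) := fun {T} hT => by
    rw [Real.sq_sqrt ENNReal.toReal_nonneg, ENNReal.ofReal_toReal (ENNReal.mul_ne_top hΛ hT)]
  have hB := ae_abs_le_of_rsob (MeasureTheory.Lp.memLp V) (Real.sqrt_nonneg _) (bound hV2)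
  set B := √(latticeSum d * rsob 2 V).toReal
  have hVtop := memLp_top_of_ae_abs_le (MeasureTheory.Lp.memLp V).1 hB
  -- The same `S` bounds `u*` (taking the whole space as `Y`) and every `u_N`, which makes the
  -- constant independent of `N`.
  set S := ENNReal.ofReal (2 * ((‖f‖ / Vmin) ^ 2 + d * (‖f‖ + B * (‖f‖ / Vmin)) ^ 2))
  have hS : S ≠ ⊤ := ENNReal.ofReal_ne_top
  have hSu : rsob 2 uStar.fn ≤ S :=
    rsob_two_minimiser_le hd3 hVtop hVmin hB hVbound (Y := ⊤) (fun _ _ _ => Submodule.mem_top)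
      Submodule.mem_top fun v _ => huStar v
  have hKt : 16 * latticeSum d * (2 * (rsob 2 V + 2 * (16 * latticeSum d * S * S +
      2 * (16 * latticeSum d * S * S + 16 * latticeSum d * S * S)))) ≠ ⊤ := by
    finiteness
  obtain ⟨C₀, hC₀, main⟩ : ∃ C₀ : ℝ, 0 ≤ C₀ ∧ ∀ N : ℕ, 1 ≤ N → ∀ q ∈ fourierSpace d N,
      (∀ v ∈ fourierSpace d N, energy V f q ≤ energy V f v) →
      ‖(projN d N uStar - q).fn‖ ≤ C₀ * (((N : ℝ) ^ 3)⁻¹ * ‖uStar - projN d N uStar‖) :=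
    ⟨_, Real.sqrt_nonneg _, fun N hN q hq hqmin =>
      norm_projN_sub_le hd3 hN hVtop hVmin hVbound hB (Real.sqrt_nonneg _) (bound hS) rfl hKt
        huStar hq hqmin hSu (rsob_two_minimiser_le hd3 hVtop hVmin hB hVbound
          (fun z hz s => shift_mem_fourierSpace hz s) hq hqmin)⟩
  -- The `L²` term contributes `C₀` and the inverse inequality `7 C₀`; the added 1 ensures
  -- positivity when `C₀ = 0`.
  refine ⟨8 * C₀ + 1, by positivity, fun N hN q hq hqmin => ?_⟩
  have h1 := main N hN q hq hqmin
  have hN' : (0 : ℝ) < N := by exact_mod_cast hN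
  have h2 := norm_le_of_mem_fourierSpace hN (Submodule.sub_mem _ (projN_mem uStar) hq)
  have h3 : (N : ℝ) ^ (-1 : ℤ) * ‖projN d N uStar - q‖ ≤ 7 * ‖(projN d N uStar - q).fn‖ := by
    rw [zpow_neg_one, inv_mul_le_iff₀ hN']
    linarith
  have h4 : (N : ℝ) ^ (-3 : ℤ) = ((N : ℝ) ^ 3)⁻¹ := by
    rw [zpow_neg]
    norm_cast
  have h5 : 0 ≤ ((N : ℝ) ^ 3)⁻¹ * ‖uStar - projN d N uStar‖ := by positivity
  rw [norm_sub_rev (projN d N uStar) uStar, h4, add_mul, one_mul, mul_assoc]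
  linarith
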